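/- **Definitions.** A *quasigroup* is a nonempty set $Q$ with a binary operation such that in $x\cdot y=z$ any two of $x,y,z$ determine the third uniquely; a *loop* is a quasigroup with an identity element; a *subquasigroup* (*subloop*) is a subset that is a quasigroup (loop) under the restricted operation. Quasigroups $Q,Q'$ are *isotopic* if there are bijections $\alpha,\beta,\gamma:Q\to Q'$ with $\alpha(x)\times\beta(y)=\gamma(x\cdot y)$ for all $x,y$. Two operations $\cdot,\times$ on a set are *conjugate* if, for a fixed permutation of the three places, $x\cdot y=z$ is equivalent to $x'\times y'=z'$, where $(x',y',z')$ is that permutation of $(x,y,z)$. $Q$ and $Q'$ are *isostrophic* if one is conjugate to an isotope of the other. The *expansion* $QK_3$ is the biased graph with nodes $v_1,v_2,v_3$ and edges $ge_{ij}$ ($g\in Q$, $ij\in\{12,23,13\}$), $ge_{ij}$ joining $v_i$ and $v_j$, whose balanced circles are the triangles $\{ge_{12},he_{23},ke_{13}\}$ with $g\cdot h=k$. The *extended lift matroid* $L_0(QK_3)$ is the matroid on the edges together with an extra element $e_0$ whose circuits are: the balanced circles; the theta graphs containing no balanced circle; the unions of two unbalanced circles that have exactly one common node, or none; and the unions of an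 unbalanced circle with $\{e_0\}$. The *lift matroid* is $L(QK_3)=L_0(QK_3)\setminus e_0$. The points of a projective plane $\mathbb P$ form a matroid in which a set is independent if it has at most three points and is not a collinear triple; $\mathbb P^*$ is the dual plane, and the matroid of the lines of a plane is their matroid as points of the dual plane. A matroid *embeds as points* (*as lines*) if its ground set can be mapped injectively to points (lines) so that independent sets are exactly the sets with independent image. A *dual 3-net* consists of three distinct main lines and a set $A$ of points on them, none on two main lines, such that the line through two points of $A$ on different main lines meets the third main line in a point of $A$; it is *affine* if the main lines are concurrent. An embedded *3-net* consists of three distinct centers and a set $B$ of lines, each containing exactly one center, such that every point, other than the centers, at which two lines of $B$ meet lies on exactly three lines of $B$ and on no line spanned by two centers; it is *affine* if the centers are collinear. $L(QK_3)$ *embeds as a dual affine 3-net* if it embeds as points whose images form a dual affine 3-net, the three classes $\{ge_{ij}:g\in Q\}$ going to the three main lines; it *embeds as an affine 3-net* if it embeds as lines whose images form an affine 3-net, the three classes going to lines on the three centers. A *ternary ring* $T=(R,t)$ is a set $R$ with $t:R^3\to R$ such that: for $a\ne c$ there is a unique $x$ with $t(x,a,b)=t(x,c,d)$; there is a unique $x$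 with $t(a,b,x)=c$; for $a\ne c$ there is a unique pair $(x,y)$ with $t(a,x,y)=b$ and $t(c,x,y)=d$; and there are $0\neq1$ in $R$ with $t(0,a,b)=t(a,0,b)=b$ and $t(1,a,0)=t(a,1,0)=a$. Its *additive loop* is $T^+=(R,+)$, $a+b:=t(1,a,b)$. The plane $\mathbb P_T$ has points $[x,y],[x],\mathbf z$ and lines $\langle x,y\rangle,\langle x\rangle,\mathbf Z$ ($x,y\in R$), with incidences $[x,y]\in\langle m,k\rangle\iff t(x,m,k)=y$; $[m]\in\langle m,k\rangle$; $[x,y],\mathbf z\in\langle x\rangle$; $[x],\mathbf z\in\mathbf Z$, and no others. $T$ *coordinatizes* $\mathbb P$ if $\mathbb P\cong\mathbb P_T$. **Theorem.** Let $\mathbb P$ be a projective plane and let $Q$ be a quasigroup. The following properties are equivalent: (a) $L_0(QK_3)$ embeds as points in $\mathbb P$. (b) $L(QK_3)$ embeds as a dual affine 3-net in $\mathbb P$. (c) $L_0(QK_3)$ embeds as lines in $\mathbb P^*$. (d) $L(QK_3)$ embeds as an affine 3-net in $\mathbb P^*$. (e) There is a ternary ring $T$ coordinatizing $\mathbb P$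 such that $Q$ is isostrophic to a subquasigroup of $T^+$. (f) There is a ternary ring $T$ coordinatizing $\mathbb P$ such that $Q$ is isotopic to a subloop of $T^+$. If $Q$ is a loop, they are also equivalent to: (g) There is a ternary ring $T$ coordinatizing $\mathbb P$ such that $Q$ is isomorphic to a subloop of $T^+$. -/

import Mathlib

universe u v w

/-! ### Quasigroups and loops -/

/-- A binary operation `op` on `Q` makes `Q` a quasigroup. -/
structure IsQuasigroup {Q : Type*} (op : Q → Q → Q) : Prop where
  existsUnique_right : ∀ x z, ∃! y, op x y = z
  existsUnique_left : ∀ y z, ∃! x, op x y = z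

/-- A loop is a quasigroup with an identity element. -/
def IsLoop {Q : Type*} (op : Q → Q → Q) : Prop :=
  IsQuasigroup op ∧ ∃ e, ∀ x, op e x = x ∧ op x e = x

/-- A subset that is a quasigroup under the restricted operation. -/
structure Subquasigroup {R : Type*} (op : R → R → R) where
  carrier : Set R
  op_mem : ∀ {x y}, x ∈ carrier → y ∈ carrier → op x y ∈ carrier
  isQuasigroup : IsQuasigroup fun x y : carrier => (⟨op x y, op_mem x.2 y.2⟩ : carrier)

/-- The restricted operation of a subquasigroup. -/
def Subquasigroup.restrict {R : Type*} {op : R → R → R} (S : Subquasigroup op) :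
    S.carrier → S.carrier → S.carrier :=
  fun x y => ⟨op x y, S.op_mem x.2 y.2⟩

/-- A subloop is a subquasigroup that is a loop under the restricted operation. -/
def Subquasigroup.IsSubloop {R : Type*} {op : R → R → R} (S : Subquasigroup op) : Prop :=
  IsLoop S.restrict

/-- `α(x) × β(y) = γ(x · y)` for three bijections `α, β, γ`. -/
def Isotopic {Q Q' : Type*} (op : Q → Q → Q) (op' : Q' → Q' → Q') : Prop :=
  ∃ α β γ : Q ≃ Q', ∀ x y, op' (α x) (β y) = γ (op x y)

/-- Two operations on one set are conjugate if the equation `x₀ · x₁ = x₂` is the equation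
`y₀ × y₁ = y₂`, where `(y₀, y₁, y₂)` is a fixed permutation of `(x₀, x₁, x₂)`. -/
def Conjugate {Q : Type*} (op op' : Q → Q → Q) : Prop :=
  ∃ σ : Equiv.Perm (Fin 3), ∀ x : Fin 3 → Q,
    op (x 0) (x 1) = x 2 ↔ op' (x (σ 0)) (x (σ 1)) = x (σ 2)

/-- `op` is conjugate to an isotope of `op'`. -/
def Isostrophic {Q Q' : Type*} (op : Q → Q → Q) (op' : Q' → Q' → Q') : Prop :=
  ∃ op'' : Q → Q → Q, Isotopic op' op'' ∧ Conjugate op op''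

/-- Isomorphism of sets with a binary operation. -/
def OpIsomorphic {Q Q' : Type*} (op : Q → Q → Q) (op' : Q' → Q' → Q') : Prop :=
  ∃ f : Q ≃ Q', ∀ x y, f (op x y) = op' (f x) (f y)

/-! ### Ternary rings and their projective planes -/

/-- A (planar) ternary ring on the set `R`. -/
structure TernaryRing (R : Type u) where
  t : R → R → R → R
  zero : R
  one : R
  existsUnique_left : ∀ a b c d, a ≠ c → ∃! x, t x a b = t x c d
  existsUnique_right : ∀ a b c, ∃! x, t a b x = c
  existsUnique_pair : ∀ a b c d, a ≠ c → ∃! p : R × R, t a p.1 p.2 = b ∧ t c p.1 p.2 = d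
  zero_ne_one : zero ≠ one
  t_zero_left : ∀ a b, t zero a b = b
  t_zero_middle : ∀ a b, t a zero b = b
  t_one_left : ∀ a, t one a zero = a
  t_one_middle : ∀ a, t a one zero = a

/-- The addition `a + b = t(1, a, b)` of a ternary ring. -/
def TernaryRing.add {R : Type u} (T : TernaryRing R) (a b : R) : R := T.t T.one a b

/-- The points `[x, y]`, `[m]` and `z` of the plane of a ternary ring. -/
inductive TernaryRing.Point {R : Type u} (T : TernaryRing R) : Type u
  | affine (x y : R)
  | slope (m : R)
  | vertical

/-- The lines `⟨m, k⟩`, `⟨x⟩` and `Z` of the plane of a ternary ring. -/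
inductive TernaryRing.Line {R : Type u} (T : TernaryRing R) : Type u
  | affine (m k : R)
  | vertical (x : R)
  | infinity

/-- Incidence in the plane of a ternary ring. -/
def TernaryRing.Incident {R : Type u} (T : TernaryRing R) : T.Point → T.Line → Prop
  | .affine x y, .affine m k => T.t x m k = y
  | .affine x _, .vertical x' => x = x'
  | .affine _ _, .infinity => False
  | .slope m, .affine m' _ => m = m'
  | .slope _, .vertical _ => False
  | .slope _, .infinity => True
  | .vertical, .affine _ _ => False
  | .vertical, .vertical _ => True
  | .vertical, .infinity => True

/-- The incidence structure `(P, L)` is (isomorphic to) the plane of `T`. -/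
def TernaryRing.Coordinatizes {R : Type u} (T : TernaryRing R) (P : Type*) (L : Type*)
    [Membership P L] : Prop :=
  ∃ (f : P ≃ T.Point) (g : L ≃ T.Line), ∀ p l, p ∈ l ↔ T.Incident (f p) (g l)

/-! ### Biased graphs -/

/-- `P` is the edge set and `X` the node set of a path from `x` to `y`. -/
def Graph.IsPathSet {V E : Type*} (G : Graph V E) (x y : V) (P : Set E) (X : Set V) : Prop :=
  ∃ (n : ℕ) (a : Fin (n + 1) → V) (e : Fin n → E), Function.Injective a ∧
    a 0 = x ∧ a (Fin.last n) = y ∧ (∀ i, G.IsLink (e i) (a i.castSucc) (a i.succ)) ∧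
    P = Set.range e ∧ X = Set.range a

/-- `C` is the edge set of a simple closed path. (Here `i + 1` is cyclic.) -/
def Graph.IsCircle {V E : Type*} (G : Graph V E) (C : Set E) : Prop :=
  ∃ (n : ℕ) (a : Fin (n + 1) → V) (e : Fin (n + 1) → E), Function.Injective a ∧
    Function.Injective e ∧ (∀ i, G.IsLink (e i) (a i) (a (i + 1))) ∧ C = Set.range e

/-- `T` is the edge set of a theta graph: the union of three internally disjoint paths with the
same two endpoints. -/
def Graph.IsTheta {V E : Type*} (G : Graph V E) (T : Set E) : Prop :=
  ∃ (x y : V) (P : Fin 3 → Set E) (X : Fin 3 → Set V), x ≠ y ∧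
    (∀ i, G.IsPathSet x y (P i) (X i)) ∧
    (∀ i j, i ≠ j → Disjoint (P i) (P j) ∧ X i ∩ X j = {x, y}) ∧ T = ⋃ i, P i

/-- The nodes incident with an edge set. -/
def Graph.nodes {V E : Type*} (G : Graph V E) (S : Set E) : Set V := {x | ∃ e ∈ S, G.Inc e x}

/-- A biased graph without half edges: a graph with a class of circles, called balanced, such that
no theta subgraph contains exactly two balanced circles. -/
structure BiasedGraph (V E : Type*) where
  graph : Graph V E
  balanced : Set (Set E)
  isCircle : ∀ C ∈ balanced, graph.IsCircle C
  theta : ∀ T, graph.IsTheta T → {C | C ∈ balanced ∧ C ⊆ T}.ncard ≠ 2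

/-- The circuits of the extended lift matroid of a biased graph without half edges. The ground set
consists of the edges `some e` and the extra element `none`. -/
inductive BiasedGraph.IsLiftCircuit {V E : Type*} (Ω : BiasedGraph V E) : Set (Option E) → Prop
  | balanced (C : Set E) (hC : C ∈ Ω.balanced) : IsLiftCircuit Ω (some '' C)
  | theta (T : Set E) (hT : Ω.graph.IsTheta T) (h : ∀ C, C ⊆ T → C ∉ Ω.balanced) :
      IsLiftCircuit Ω (some '' T)
  | joined (C D : Set E) (hC : Ω.graph.IsCircle C) (hD : Ω.graph.IsCircle D)
      (hCb : C ∉ Ω.balanced) (hDb : D ∉ Ω.balanced)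
      (h : ∃ x, Ω.graph.nodes C ∩ Ω.graph.nodes D = {x}) : IsLiftCircuit Ω (some '' (C ∪ D))
  | disjoint (C D : Set E) (hC : Ω.graph.IsCircle C) (hD : Ω.graph.IsCircle D)
      (hCb : C ∉ Ω.balanced) (hDb : D ∉ Ω.balanced)
      (h : Ω.graph.nodes C ∩ Ω.graph.nodes D = ∅) : IsLiftCircuit Ω (some '' (C ∪ D))
  | extra (C : Set E) (hC : Ω.graph.IsCircle C) (hCb : C ∉ Ω.balanced) :
      IsLiftCircuit Ω (insert none (some '' C))

/-- Independence in the extended lift matroid: no circuit is contained in the set. -/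
def BiasedGraph.LiftIndep {V E : Type*} (Ω : BiasedGraph V E) (I : Set (Option E)) : Prop :=
  ∀ C, Ω.IsLiftCircuit C → ¬ C ⊆ I

/-! ### The matroid of a linear space and of a projective plane -/

/-- At most three points, and not three points of one of the lines in `𝓛`. -/
def LineIndep {α : Type*} (𝓛 : Set (Set α)) (I : Set α) : Prop :=
  I.encard ≤ 3 ∧ ∀ l ∈ 𝓛, I ⊆ l → I.encard ≤ 2

theorem LineIndep.subset {α : Type*} {𝓛 : Set (Set α)} {I J : Set α} (hJ : LineIndep 𝓛 J)
    (h : I ⊆ J) : LineIndep 𝓛 I := by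
  refine ⟨(Set.encard_le_encard h).trans hJ.1, fun l hl hIl => ?_⟩
  by_contra! hI
  have hJ3 : J.encard ≤ I.encard := by
    refine hJ.1.trans ?_
    have := Order.add_one_le_of_lt hI
    norm_num at this
    exact this
  have hfin : J.Finite := Set.finite_of_encard_le_coe (k := 3) hJ.1
  obtain rfl := (hfin.subset h).eq_of_subset_of_encard_le h hJ3
  exact absurd (hJ.2 l hl hIl) (not_le.2 hI)

/-- The matroid of rank at most three given by a family of lines, any two of which have at most
one common point. -/
def lineMatroid {α : Type*} (𝓛 : Set (Set α))
    (h𝓛 : ∀ l ∈ 𝓛, ∀ l' ∈ 𝓛, ∀ a b, a ≠ b → a ∈ l → b ∈ l → a ∈ l' → b ∈ l' → l = l') :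
    Matroid α :=
  (IndepMatroid.ofBddAugment Set.univ (LineIndep 𝓛) (by simp [LineIndep])
    (fun _ _ hJ h => hJ.subset h)
    (by
      intro I J hI hJ hIJ
      by_contra! hcon
      have hI1 : I.encard + 1 ≤ 3 := (Order.add_one_le_of_lt hIJ).trans hJ.1
      have key : ∀ e ∈ J, e ∉ I → ∃ l ∈ 𝓛, insert e I ⊆ l ∧ 2 ≤ I.encard := by
        intro e he heI
        have := hcon e he heI
        unfold LineIndep at this
        rw [Set.encard_insert_of_notMem heI] at this
        push Not at this
        obtain ⟨l, hl, hs, h2⟩ := this hI1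
        refine ⟨l, hl, hs, ?_⟩
        have h3 := Order.add_one_le_of_lt h2
        have h4 : (1 : ℕ∞) + 2 ≤ 1 + I.encard := by rwa [add_comm, add_comm 1]
        exact (ENat.add_le_add_iff_left (by simp)).1 h4
      obtain ⟨e, he, heI⟩ : ∃ e ∈ J, e ∉ I := by
        by_contra! hsub
        exact absurd (Set.encard_le_encard hsub) (not_le.2 hIJ)
      obtain ⟨l, hl, hs, h2⟩ := key e he heI
      obtain ⟨a, ha, b, hb, hab⟩ : ∃ a ∈ I, ∃ b ∈ I, a ≠ b := by
        have := Set.one_lt_encard_iff.1 (lt_of_lt_of_le (by norm_num) h2)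
        obtain ⟨a, b, ha, hb, hab⟩ := this
        exact ⟨a, ha, b, hb, hab⟩
      have hJl : J ⊆ l := by
        intro f hf
        by_cases hfI : f ∈ I
        · exact hs (Set.mem_insert_of_mem _ hfI)
        · obtain ⟨l', hl', hs', -⟩ := key f hf hfI
          have := h𝓛 l hl l' hl' a b hab (hs (Set.mem_insert_of_mem _ ha))
            (hs (Set.mem_insert_of_mem _ hb)) (hs' (Set.mem_insert_of_mem _ ha))
            (hs' (Set.mem_insert_of_mem _ hb))
          rw [this]
          exact hs' (Set.mem_insert _ _)
      exact absurd (hJ.2 l hl hJl) (not_le.2 (lt_of_le_of_lt h2 hIJ)))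
    ⟨3, fun _ hI => hI.1⟩ (fun _ _ => Set.subset_univ _)).matroid

theorem lineMatroid_indep_iff {α : Type*} {𝓛 : Set (Set α)}
    {h𝓛 : ∀ l ∈ 𝓛, ∀ l' ∈ 𝓛, ∀ a b, a ≠ b → a ∈ l → b ∈ l → a ∈ l' → b ∈ l' → l = l'}
    {I : Set α} : (lineMatroid 𝓛 h𝓛).Indep I ↔ LineIndep 𝓛 I := by
  exact Iff.rfl

/-- The matroid of projective dependence on the points of a projective plane: a set of points is
independent if it has at most three elements and is not a set of three collinear points. -/
def planeMatroid (P L : Type*) [Membership P L] [Configuration.ProjectivePlane P L] : Matroid P :=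
  lineMatroid (Set.range fun l : L => {p : P | p ∈ l}) (by
    rintro _ ⟨l, rfl⟩ _ ⟨l', rfl⟩ a b hab ha hb ha' hb'
    obtain h | h := Configuration.Nondegenerate.eq_or_eq (P := P) (L := L) ha hb ha' hb'
    · exact absurd h hab
    · rw [h])

/-! ### Quasigroup expansions of the triangle -/

/-- The edges of the triangle. -/
inductive K3Edge
  | e12
  | e23
  | e13

/-- The endpoints of an edge of the triangle, whose nodes are `0, 1, 2`. -/
def K3Edge.ends : K3Edge → Sym2 (Fin 3)
  | .e12 => s(0, 1)
  | .e23 => s(1, 2)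
  | .e13 => s(0, 2)

/-- The underlying graph of the expansion: each edge of the triangle is replaced by `Q` parallel
edges. -/
def expansionGraph (Q : Type*) : Graph (Fin 3) (Q × K3Edge) where
  vertexSet := Set.univ
  IsLink e x y := s(x, y) = e.2.ends
  isLink_symm _ _ := ⟨fun _ _ h => by rw [Sym2.eq_swap]; exact h⟩
  eq_or_eq_of_isLink_of_isLink e x y a b h h' := by
    have := h.trans h'.symm
    rw [Sym2.eq_iff] at this
    tauto
  left_mem_of_isLink _ _ _ _ := Set.mem_univ _

/-- The balanced circles: the triangles `{g e₁₂, h e₂₃, k e₁₃}` with `g · h = k`. -/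
def expansionBalanced {Q : Type*} (op : Q → Q → Q) : Set (Set (Q × K3Edge)) :=
  {C | ∃ g h k, op g h = k ∧ C = {(g, .e12), (h, .e23), (k, .e13)}}

section expansionLemmas

theorem K3Edge.ends_injective : Function.Injective K3Edge.ends := by
  intro i j h
  cases i <;> cases j <;> first | rfl | (exfalso; revert h; decide)

theorem K3Edge.ne_of_link {x y : Fin 3} {i : K3Edge} (h : s(x, y) = i.ends) : x ≠ y := by
  rintro rfl
  cases i <;> · revert x; decide

variable {Q : Type*}

theorem expansion_isCircle_triangle (g h k : Q) :
    (expansionGraph Q).IsCircle {(g, .e12), (h, .e23), (k, .e13)} := by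
  refine ⟨2, ![0, 1, 2], ![(g, .e12), (h, .e23), (k, .e13)], by decide, ?_, ?_, ?_⟩
  · intro i j hij
    fin_cases i <;> fin_cases j <;> simp_all
  · intro i
    fin_cases i <;> simp [expansionGraph, K3Edge.ends]
  · ext x
    simp
    tauto

theorem expansion_isCircle_digon {g g' : Q} (i : K3Edge) (h : g ≠ g') :
    (expansionGraph Q).IsCircle {(g, i), (g', i)} := by
  obtain ⟨x, y, hxy⟩ : ∃ x y, s(x, y) = i.ends := by
    cases i <;> exact ⟨_, _, rfl⟩
  have hne := K3Edge.ne_of_link hxy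
  refine ⟨1, ![x, y], ![(g, i), (g', i)], ?_, ?_, ?_, ?_⟩
  · intro a b hab
    fin_cases a <;> fin_cases b <;> simp_all
  · intro a b hab
    fin_cases a <;> fin_cases b <;> simp_all
  · intro a
    fin_cases a
    · exact hxy
    · exact (Sym2.eq_swap).trans hxy
  · ext x
    simp
    tauto

theorem expansion_isCircle_cases {C : Set (Q × K3Edge)} (hC : (expansionGraph Q).IsCircle C) :
    (∃ i g g', g ≠ g' ∧ C = {(g, i), (g', i)}) ∨
      ∃ g h k, C = {(g, .e12), (h, .e23), (k, .e13)} := by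
  obtain ⟨n, a, e, ha, he, hl, rfl⟩ := hC
  have hn : n + 1 ≤ 3 := by simpa using Fintype.card_le_of_injective a ha
  obtain rfl | rfl | rfl : n = 0 ∨ n = 1 ∨ n = 2 := by omega
  · exact absurd rfl (K3Edge.ne_of_link (hl 0))
  · left
    have h0 : s(a 0, a 1) = (e 0).2.ends := hl 0
    have h1 : s(a 1, a 0) = (e 1).2.ends := hl 1
    have h2 : (e 1).2 = (e 0).2 :=
      K3Edge.ends_injective (h1.symm.trans (Sym2.eq_swap.trans h0))
    refine ⟨(e 0).2, (e 0).1, (e 1).1, fun h => ?_, ?_⟩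
    · exact absurd (he (Prod.ext h h2.symm)) (by decide)
    · have h3 : ((e 1).1, (e 0).2) = e 1 := Prod.ext rfl h2.symm
      rw [h3]
      ext x
      simp [eq_comm]
  · right
    have h0 : s(a 0, a 1) = (e 0).2.ends := hl 0
    have h1 : s(a 1, a 2) = (e 1).2.ends := hl 1
    have h2 : s(a 2, a 0) = (e 2).2.ends := hl 2
    have n01 : a 0 ≠ a 1 := fun h => absurd (ha h) (by decide)
    have n02 : a 0 ≠ a 2 := fun h => absurd (ha h) (by decide)
    have n12 : a 1 ≠ a 2 := fun h => absurd (ha h) (by decide)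
    have hr : Set.range e = {e 0, e 1, e 2} := by
      ext x
      simp [Fin.exists_fin_succ, eq_comm]
    have d01 : (e 0).2 ≠ (e 1).2 := by
      intro h
      rw [h, ← h1, Sym2.eq_iff] at h0
      tauto
    have d02 : (e 0).2 ≠ (e 2).2 := by
      intro h
      rw [h, ← h2, Sym2.eq_iff] at h0
      tauto
    have d12 : (e 1).2 ≠ (e 2).2 := by
      intro h
      rw [h, ← h2, Sym2.eq_iff] at h1
      tauto
    rw [hr]
    generalize e 0 = e0 at *
    generalize e 1 = e1 at *
    generalize e 2 = e2 at *
    obtain ⟨q0, i0⟩ := e0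
    obtain ⟨q1, i1⟩ := e1
    obtain ⟨q2, i2⟩ := e2
    clear hr h0 h1 h2 hl he
    cases i0 <;> cases i1 <;> cases i2 <;> simp at d01 d02 d12
    · exact ⟨q0, q1, q2, by ext; simp⟩
    · exact ⟨q0, q2, q1, by ext; simp; tauto⟩
    · exact ⟨q1, q0, q2, by ext; simp; tauto⟩
    · exact ⟨q2, q0, q1, by ext; simp; tauto⟩
    · exact ⟨q1, q2, q0, by ext; simp; tauto⟩
    · exact ⟨q2, q1, q0, by ext; simp; tauto⟩

theorem expansion_isPathSet_cases {x y : Fin 3} {P : Set (Q × K3Edge)} {X : Set (Fin 3)}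
    (hxy : x ≠ y) (hP : (expansionGraph Q).IsPathSet x y P X) :
    (∃ e, P = {e} ∧ s(x, y) = e.2.ends) ∨
      ∃ z e f, z ≠ x ∧ z ≠ y ∧ z ∈ X ∧ P = {e, f} ∧ s(x, z) = e.2.ends ∧ s(z, y) = f.2.ends := by
  obtain ⟨n, a, e, ha, rfl, rfl, hl, rfl, rfl⟩ := hP
  have hn : n + 1 ≤ 3 := by simpa using Fintype.card_le_of_injective a ha
  obtain rfl | rfl | rfl : n = 0 ∨ n = 1 ∨ n = 2 := by omega
  · exact absurd rfl hxy
  · left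
    refine ⟨e 0, ?_, hl 0⟩
    ext x
    simp [eq_comm]
  · right
    refine ⟨a 1, e 0, e 1, fun h => absurd (ha h) (by decide),
      fun h => absurd (ha h) (by decide), ⟨1, rfl⟩, ?_, hl 0, hl 1⟩
    ext x
    simp [eq_comm]

/-- Either all edges of a theta graph are parallel, or it has at least four edges and, except for
one parallel class, at most one edge in each parallel class. -/
theorem expansion_isTheta_cases {T : Set (Q × K3Edge)} (hT : (expansionGraph Q).IsTheta T) :
    3 ≤ T.encard ∧ ∃ i, (∀ e ∈ T, ∀ f ∈ T, e.2 = f.2 → e.2 ≠ i → e = f) ∧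
      ((∀ e ∈ T, e.2 = i) ∨ 4 ≤ T.encard) := by
  obtain ⟨x, y, P, X, hxy, hP, hd, rfl⟩ := hT
  obtain ⟨i, hi⟩ : ∃ i : K3Edge, s(x, y) = i.ends := by
    revert hxy
    fin_cases x <;> fin_cases y <;> intro hxy <;> first
      | exact absurd rfl hxy
      | exact ⟨.e12, by decide⟩
      | exact ⟨.e23, by decide⟩
      | exact ⟨.e13, by decide⟩
  have hne : ∀ j, (P j).Nonempty := by
    intro j
    obtain ⟨e, he, -⟩ | ⟨-, e, f, -, -, -, he, -⟩ := expansion_isPathSet_cases hxy (hP j)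
    · exact ⟨e, by simp [he]⟩
    · exact ⟨e, by simp [he]⟩
  have hU : (⋃ j, P j) = P 0 ∪ (P 1 ∪ P 2) := by
    ext x
    simp [Fin.exists_fin_succ]
  have hcard : (⋃ j, P j).encard = (P 0).encard + ((P 1).encard + (P 2).encard) := by
    rw [hU, Set.encard_union_eq, Set.encard_union_eq (hd 1 2 (by decide)).1]
    exact Set.disjoint_union_right.2 ⟨(hd 0 1 (by decide)).1, (hd 0 2 (by decide)).1⟩
  have h1 : ∀ j, 1 ≤ (P j).encard := fun j => Set.one_le_encard_iff_nonempty.2 (hne j)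
  have h3 : 3 ≤ (⋃ j, P j).encard := by
    rw [hcard]
    calc (3 : ℕ∞) = 1 + (1 + 1) := by norm_num
      _ ≤ _ := by gcongr <;> exact h1 _
  refine ⟨h3, i, ?_⟩
  by_cases hlong : ∃ j z e f, z ≠ x ∧ z ≠ y ∧ z ∈ X j ∧ P j = {e, f} ∧ s(x, z) = e.2.ends ∧
      s(z, y) = f.2.ends
  · obtain ⟨j, z, e, f, hzx, hzy, hz, hPj, he, hf⟩ := hlong
    have hef : e.2 ≠ f.2 := by
      intro h
      rw [h, ← hf, Sym2.eq_iff] at he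
      tauto
    have hother : ∀ k, k ≠ j → ∀ e' ∈ P k, e'.2 = i := by
      intro k hk e' he'
      obtain ⟨e1, h1, h2⟩ | ⟨z', e1, f1, hzx', hzy', hz', -, -⟩ :=
        expansion_isPathSet_cases hxy (hP k)
      · rw [h1, Set.mem_singleton_iff] at he'
        subst he'
        exact K3Edge.ends_injective (h2.symm.trans hi)
      · exfalso
        have hzz : z' = z := by omega
        subst hzz
        have : z' ∈ X k ∩ X j := ⟨hz', hz⟩
        rw [(hd k j hk).2] at this
        simp_all
    have hmem : ∀ e' ∈ ⋃ k, P k, e'.2 ≠ i → e' = e ∨ e' = f := by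
      intro e' he' hi'
      obtain ⟨k, hk⟩ := Set.mem_iUnion.1 he'
      by_cases hkj : k = j
      · subst hkj
        simpa [hPj] using hk
      · exact absurd (hother k hkj e' hk) hi'
    refine ⟨?_, Or.inr ?_⟩
    · intro e1 he1 f1 hf1 h hi1
      obtain rfl | rfl := hmem e1 he1 hi1 <;> obtain rfl | rfl := hmem f1 hf1 (h ▸ hi1)
      · rfl
      · exact absurd h hef
      · exact absurd h.symm hef
      · rfl
    · have h2 : (P j).encard = 2 := by
        rw [hPj]
        exact Set.encard_pair (fun h => hef (by rw [h]))
      rw [hcard]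
      have e4 : (4 : ℕ∞) = 2 + (1 + 1) := by norm_num
      have e4' : (4 : ℕ∞) = 1 + (2 + 1) := by norm_num
      have e4'' : (4 : ℕ∞) = 1 + (1 + 2) := by norm_num
      fin_cases j
      · rw [e4]
        gcongr
        exacts [h2.ge, h1 _, h1 _]
      · rw [e4']
        gcongr
        exacts [h1 _, h2.ge, h1 _]
      · rw [e4'']
        gcongr
        exacts [h1 _, h1 _, h2.ge]
  · have hall : ∀ e ∈ ⋃ k, P k, e.2 = i := by
      intro e he
      obtain ⟨k, hk⟩ := Set.mem_iUnion.1 he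
      obtain ⟨e1, h1, h2⟩ | h := expansion_isPathSet_cases hxy (hP k)
      · rw [h1, Set.mem_singleton_iff] at hk
        subst hk
        exact K3Edge.ends_injective (h2.symm.trans hi)
      · exact absurd ⟨k, h⟩ hlong
    exact ⟨fun e he _ _ _ h => absurd (hall e he) h, Or.inl hall⟩

theorem expansion_theta {op : Q → Q → Q} (hop : IsQuasigroup op) (T : Set (Q × K3Edge))
    (hT : (expansionGraph Q).IsTheta T) : {C | C ∈ expansionBalanced op ∧ C ⊆ T}.ncard ≠ 2 := by
  intro h2
  obtain ⟨C, D, hne, hCD⟩ := Set.ncard_eq_two.1 h2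
  have hC : C ∈ {C | C ∈ expansionBalanced op ∧ C ⊆ T} := by simp [hCD]
  have hD : D ∈ {C | C ∈ expansionBalanced op ∧ C ⊆ T} := by simp [hCD]
  obtain ⟨⟨g, h, k, hg, rfl⟩, hCT⟩ := hC
  obtain ⟨⟨g', h', k', hg', rfl⟩, hDT⟩ := hD
  obtain ⟨-, i, hi, -⟩ := expansion_isTheta_cases hT
  have m1 : (g, K3Edge.e12) ∈ T := hCT (by simp)
  have m2 : (h, K3Edge.e23) ∈ T := hCT (by simp)
  have m3 : (k, K3Edge.e13) ∈ T := hCT (by simp)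
  have n1 : (g', K3Edge.e12) ∈ T := hDT (by simp)
  have n2 : (h', K3Edge.e23) ∈ T := hDT (by simp)
  have n3 : (k', K3Edge.e13) ∈ T := hDT (by simp)
  apply hne
  have u1 : K3Edge.e12 ≠ i → g = g' := fun hh => by simpa using hi _ m1 _ n1 rfl hh
  have u2 : K3Edge.e23 ≠ i → h = h' := fun hh => by simpa using hi _ m2 _ n2 rfl hh
  have u3 : K3Edge.e13 ≠ i → k = k' := fun hh => by simpa using hi _ m3 _ n3 rfl hh
  cases i
  · obtain rfl := u2 (by simp)
    obtain rfl := u3 (by simp)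
    obtain rfl := (hop.existsUnique_left h k).unique hg hg'
    rfl
  · obtain rfl := u1 (by simp)
    obtain rfl := u3 (by simp)
    obtain rfl := (hop.existsUnique_right g k).unique hg hg'
    rfl
  · obtain rfl := u1 (by simp)
    obtain rfl := u2 (by simp)
    obtain rfl := hg.symm.trans hg'
    rfl

end expansionLemmas

/-- The quasigroup expansion `Q K₃` as a biased graph. -/
def quasigroupExpansion {Q : Type*} (op : Q → Q → Q) (hop : IsQuasigroup op) :
    BiasedGraph (Fin 3) (Q × K3Edge) where
  graph := expansionGraph Q
  balanced := expansionBalanced op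
  isCircle := by
    rintro _ ⟨g, h, k, -, rfl⟩
    exact expansion_isCircle_triangle g h k
  theta := expansion_theta hop

section liftLemmas

variable {Q : Type*}

/-- The lines with at least three points of the extended lift matroid of `Q K₃`: the parallel
classes with the extra point added, and the balanced triangles. -/
def liftLines (op : Q → Q → Q) : Set (Set (Option (Q × K3Edge))) :=
  (Set.range fun i : K3Edge => insert none (some '' {e : Q × K3Edge | e.2 = i})) ∪
    (fun C => some '' C) '' expansionBalanced op

theorem liftLines_unique {op : Q → Q → Q} (hop : IsQuasigroup op) :
    ∀ l ∈ liftLines op, ∀ l' ∈ liftLines op, ∀ a b, a ≠ b → a ∈ l → b ∈ l → a ∈ l' → b ∈ l' →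
      l = l' := by
  have key : ∀ (i : K3Edge) (g h k : Q) (a b : Option (Q × K3Edge)), a ≠ b →
      a ∈ insert none (some '' {e : Q × K3Edge | e.2 = i}) →
      b ∈ insert none (some '' {e : Q × K3Edge | e.2 = i}) →
      a ∈ some '' ({(g, .e12), (h, .e23), (k, .e13)} : Set (Q × K3Edge)) →
      b ∈ some '' ({(g, .e12), (h, .e23), (k, .e13)} : Set (Q × K3Edge)) → False := by
    intro i g h k a b hab ha hb ha' hb'
    cases i <;> simp at ha hb ha' hb' <;> grind
  rintro _ (⟨i, rfl⟩ | ⟨_, ⟨g, h, k, hg, rfl⟩, rfl⟩) _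
    (⟨j, rfl⟩ | ⟨_, ⟨g', h', k', hg', rfl⟩, rfl⟩) a b hab ha hb ha' hb'
  · have : i = j := by
      simp at ha hb ha' hb'
      grind
    rw [this]
  · exact (key _ _ _ _ _ _ hab ha hb ha' hb').elim
  · exact (key _ _ _ _ _ _ hab ha' hb' ha hb).elim
  · have u1 : g = g' → h = h' → k = k' := by
      rintro rfl rfl
      exact hg.symm.trans hg'
    have u2 : g = g' → k = k' → h = h' := by
      rintro rfl rfl
      exact (hop.existsUnique_right g k).unique hg hg'
    have u3 : h = h' → k = k' → g = g' := by
      rintro rfl rfl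
      exact (hop.existsUnique_left h k).unique hg hg'
    have : g = g' ∧ h = h' ∧ k = k' := by
      simp at ha hb ha' hb'
      grind
    obtain ⟨rfl, rfl, rfl⟩ := this
    rfl

theorem expansion_isPathSet_one {x y : Fin 3} {e : Q × K3Edge} (h : s(x, y) = e.2.ends) :
    (expansionGraph Q).IsPathSet x y {e} {x, y} := by
  have hne := K3Edge.ne_of_link h
  refine ⟨1, ![x, y], ![e], ?_, rfl, rfl, ?_, ?_, ?_⟩
  · intro a b hab
    fin_cases a <;> fin_cases b <;> simp_all
  · intro i
    fin_cases i
    exact h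
  · simp
  · ext z
    simp
    tauto

theorem expansion_isPathSet_two {x y z : Fin 3} {e f : Q × K3Edge} (hxy : x ≠ y)
    (h : s(x, z) = e.2.ends) (h' : s(z, y) = f.2.ends) :
    (expansionGraph Q).IsPathSet x y {e, f} {x, z, y} := by
  have hne := K3Edge.ne_of_link h
  have hne' := K3Edge.ne_of_link h'
  refine ⟨2, ![x, z, y], ![e, f], ?_, rfl, rfl, ?_, ?_, ?_⟩
  · intro a b hab
    fin_cases a <;> fin_cases b <;> simp_all
  · intro i
    fin_cases i
    exacts [h, h']
  · ext w
    simp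
    tauto
  · ext w
    simp
    tauto

theorem expansion_isTheta_parallel {e f g : Q × K3Edge} (hef : e ≠ f) (hfg : f ≠ g) (heg : e ≠ g)
    (h1 : e.2 = f.2) (h2 : e.2 = g.2) : (expansionGraph Q).IsTheta {e, f, g} := by
  obtain ⟨x, y, hxy⟩ : ∃ x y, s(x, y) = e.2.ends := by
    cases e.2 <;> exact ⟨_, _, rfl⟩
  refine ⟨x, y, ![{e}, {f}, {g}], ![{x, y}, {x, y}, {x, y}], K3Edge.ne_of_link hxy, ?_, ?_, ?_⟩
  · intro i
    fin_cases i
    exacts [expansion_isPathSet_one hxy, expansion_isPathSet_one (h1 ▸ hxy),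
      expansion_isPathSet_one (h2 ▸ hxy)]
  · intro i j hij
    fin_cases i <;> fin_cases j <;> simp_all [eq_comm]
  · ext w
    simp [Fin.exists_fin_succ]

theorem expansion_isTheta_four {e f g h : Q × K3Edge} (hef : e ≠ f) (h1 : e.2 = f.2)
    (hg : g.2 ≠ e.2) (hh : h.2 ≠ e.2) (hgh : g.2 ≠ h.2) :
    (expansionGraph Q).IsTheta {e, f, g, h} := by
  obtain ⟨x, y, z, hxy, hxz, hzy⟩ : ∃ x y z, s(x, y) = e.2.ends ∧ s(x, z) = g.2.ends ∧
      s(z, y) = h.2.ends := by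
    generalize e.2 = a at *
    generalize g.2 = b at *
    generalize h.2 = c at *
    cases a <;> cases b <;> cases c <;> first | (simp at hg hh hgh; done) | skip
    exacts [⟨1, 0, 2, by decide⟩, ⟨0, 1, 2, by decide⟩, ⟨1, 2, 0, by decide⟩, ⟨2, 1, 0, by decide⟩,
      ⟨0, 2, 1, by decide⟩, ⟨2, 0, 1, by decide⟩]
  have hne := K3Edge.ne_of_link hxy
  have hne1 := K3Edge.ne_of_link hxz
  have hne2 := K3Edge.ne_of_link hzy
  refine ⟨x, y, ![{e}, {f}, {g, h}], ![{x, y}, {x, y}, {x, z, y}], hne, ?_, ?_, ?_⟩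
  · intro i
    fin_cases i
    exacts [expansion_isPathSet_one hxy, expansion_isPathSet_one (h1 ▸ hxy),
      expansion_isPathSet_two hne hxz hzy]
  · have d1 : e ≠ g := fun h => hg (by rw [h])
    have d2 : e ≠ h := fun h => hh (by rw [h])
    have d3 : f ≠ g := fun h => hg (by rw [h1, h])
    have d4 : f ≠ h := fun h => hh (by rw [h1, h])
    have d5 : ({x, y} : Set (Fin 3)) ∩ {x, z, y} = {x, y} := by
      ext w
      simp
      tauto
    have d6 : ({x, z, y} : Set (Fin 3)) ∩ {x, y} = {x, y} := by
      rw [Set.inter_comm, d5]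
    intro i j hij
    fin_cases i <;> fin_cases j <;> simp [d5, d6] at hij ⊢ <;> simp_all [eq_comm]
  · ext w
    simp [Fin.exists_fin_succ]

theorem expansion_nodes_digon (i : K3Edge) (g g' : Q) :
    (expansionGraph Q).nodes {(g, i), (g', i)} = {x | x ∈ i.ends} := by
  ext x
  simp only [Graph.nodes, Graph.Inc, expansionGraph, Set.mem_ofPred_eq, Set.mem_insert_iff,
    Set.mem_singleton_iff]
  constructor
  · rintro ⟨e, rfl | rfl, y, hy⟩ <;> exact hy ▸ Sym2.mem_mk_left x y
  · intro hx
    obtain ⟨y, hy⟩ := hx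
    exact ⟨_, Or.inl rfl, y, hy.symm⟩

theorem digon_notMem_balanced (op : Q → Q → Q) (i : K3Edge) (g g' : Q) :
    ({(g, i), (g', i)} : Set (Q × K3Edge)) ∉ expansionBalanced op := by
  rintro ⟨a, b, c, -, h⟩
  have h1 : (a, K3Edge.e12) ∈ ({(g, i), (g', i)} : Set (Q × K3Edge)) := by rw [h]; simp
  have h2 : (b, K3Edge.e23) ∈ ({(g, i), (g', i)} : Set (Q × K3Edge)) := by rw [h]; simp
  simp at h1 h2
  grind

theorem expansion_liftIndep_iff {op : Q → Q → Q} (hop : IsQuasigroup op)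
    (I : Set (Option (Q × K3Edge))) :
    (quasigroupExpansion op hop).LiftIndep I ↔ LineIndep (liftLines op) I := by
  have hpair : ∀ {e f : Q × K3Edge}, e ≠ f → e.2 = f.2 →
      (expansionGraph Q).IsCircle {e, f} ∧ {e, f} ∉ expansionBalanced op ∧
      (expansionGraph Q).nodes {e, f} = {x | x ∈ e.2.ends} := by
    rintro ⟨g, i⟩ ⟨h, j⟩ hne (rfl : i = j)
    exact ⟨expansion_isCircle_digon i (by rintro rfl; exact hne rfl), digon_notMem_balanced _ _ _ _,
      expansion_nodes_digon _ _ _⟩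
  have hodd : ∀ C D : Set (Q × K3Edge), (expansionGraph Q).IsCircle C →
      (expansionGraph Q).IsCircle D → (∀ x y, x ∈ (expansionGraph Q).nodes C →
        x ∈ (expansionGraph Q).nodes D → y ∈ (expansionGraph Q).nodes C →
        y ∈ (expansionGraph Q).nodes D → x = y) → 4 ≤ (C ∪ D).encard := by
    intro C D hC hD hCD
    have h2 : ∀ C, (expansionGraph Q).IsCircle C → 2 ≤ C.encard := by
      intro C hC
      obtain ⟨i, g, g', hne, rfl⟩ | ⟨g, h, k, rfl⟩ := expansion_isCircle_cases hC
      · rw [Set.encard_pair (by simpa using hne)]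
      · rw [← Set.encard_pair (show ((g, .e12) : Q × K3Edge) ≠ (h, .e23) by simp)]
        exact Set.encard_le_encard (by intro; simp; tauto)
    rw [Set.encard_union_eq]
    · calc (4 : ℕ∞) = 2 + 2 := by norm_num
        _ ≤ _ := by gcongr <;> exact h2 _ ‹_›
    · rw [Set.disjoint_left]
      intro e heC heD
      obtain ⟨x, y, hxy⟩ : ∃ x y, s(x, y) = e.2.ends := by
        cases e.2 <;> exact ⟨_, _, rfl⟩
      exact K3Edge.ne_of_link hxy (hCD x y ⟨e, heC, y, hxy⟩ ⟨e, heD, y, hxy⟩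
        ⟨e, heC, x, Sym2.eq_swap.trans hxy⟩ ⟨e, heD, x, Sym2.eq_swap.trans hxy⟩)
  have hsome : Function.Injective (some : Q × K3Edge → _) := Option.some_injective _
  have not4 : ∀ {C : Set (Option (Q × K3Edge))}, 4 ≤ C.encard → ¬ LineIndep (liftLines op) C :=
    fun h hC => absurd (h.trans hC.1) (by norm_num)
  have not3 : ∀ {C l : Set (Option (Q × K3Edge))}, 3 ≤ C.encard → l ∈ liftLines op → C ⊆ l →
      ¬ LineIndep (liftLines op) C :=
    fun h hl hCl hC => absurd (h.trans (hC.2 _ hl hCl)) (by norm_num)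
  constructor
  · intro hI
    have F1 : ∀ e f, none ∈ I → some e ∈ I → some f ∈ I → e.2 = f.2 → e = f := by
      intro e f h0 he hf h
      by_contra hne
      refine hI _ (.extra _ (hpair hne h).1 (hpair hne h).2.1) ?_
      rintro _ (rfl | ⟨_, (rfl | rfl), rfl⟩) <;> assumption
    have F2 : ∀ e f g, some e ∈ I → some f ∈ I → some g ∈ I → e.2 = f.2 → e.2 = g.2 →
        e = f ∨ f = g ∨ e = g := by
      intro e f g he hf hg h1 h2
      by_contra! hne
      refine hI _ (.theta _ (expansion_isTheta_parallel hne.1 hne.2.1 hne.2.2 h1 h2) ?_) ?_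
      · rintro _ hC ⟨a, b, c, -, rfl⟩
        have m1 := hC (show (a, K3Edge.e12) ∈ _ by simp)
        have m2 := hC (show (b, K3Edge.e23) ∈ _ by simp)
        simp at m1 m2
        grind
      · rintro _ ⟨_, (rfl | rfl | rfl), rfl⟩ <;> assumption
    have F3 : ∀ g h k, some (g, .e12) ∈ I → some (h, .e23) ∈ I → some (k, .e13) ∈ I →
        op g h ≠ k := by
      intro g h k hg hh hk hgk
      refine hI _ (.balanced _ ⟨g, h, k, hgk, rfl⟩) ?_
      rintro _ ⟨_, (rfl | rfl | rfl), rfl⟩ <;> assumption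
    have F4' : ∀ g h k, none ∈ I → some (g, .e12) ∈ I → some (h, .e23) ∈ I →
        some (k, .e13) ∈ I → False := by
      intro g h k h0 hg hh hk
      refine hI _ (.extra _ (expansion_isCircle_triangle g h k) ?_) ?_
      · rintro ⟨g', h', k', hgk, hs⟩
        have m1 : (g', K3Edge.e12) ∈ ({(g, .e12), (h, .e23), (k, .e13)} : Set (Q × K3Edge)) := by
          rw [hs]; simp
        have m2 : (h', K3Edge.e23) ∈ ({(g, .e12), (h, .e23), (k, .e13)} : Set (Q × K3Edge)) := by
          rw [hs]; simp
        have m3 : (k', K3Edge.e13) ∈ ({(g, .e12), (h, .e23), (k, .e13)} : Set (Q × K3Edge)) := by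
          rw [hs]; simp
        simp at m1 m2 m3
        subst m1 m2 m3
        exact F3 _ _ _ hg hh hk hgk
      · rintro _ (rfl | ⟨_, (rfl | rfl | rfl), rfl⟩) <;> assumption
    have F4 : ∀ e f g, none ∈ I → some e ∈ I → some f ∈ I → some g ∈ I → e.2 ≠ f.2 → e.2 ≠ g.2 →
        f.2 ≠ g.2 → False := by
      rintro ⟨a, i⟩ ⟨b, j⟩ ⟨c, k⟩ h0 he hf hg h1 h2 h3
      cases i <;> cases j <;> cases k <;> simp at h1 h2 h3
      exacts [F4' _ _ _ h0 he hf hg, F4' _ _ _ h0 he hg hf, F4' _ _ _ h0 hf he hg,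
        F4' _ _ _ h0 hg he hf, F4' _ _ _ h0 hf hg he, F4' _ _ _ h0 hg hf he]
    have F5 : ∀ e f e' f', some e ∈ I → some f ∈ I → some e' ∈ I → some f' ∈ I → e ≠ f → e' ≠ f' →
        e.2 = f.2 → e'.2 = f'.2 → e.2 = e'.2 := by
      intro e f e' f' he hf he' hf' hne hne' h h'
      by_contra hee
      obtain ⟨c1, b1, n1⟩ := hpair hne h
      obtain ⟨c2, b2, n2⟩ := hpair hne' h'
      refine hI _ (.joined _ _ c1 c2 b1 b2 ?_) ?_
      · change ∃ x, (expansionGraph Q).nodes _ ∩ (expansionGraph Q).nodes _ = {x}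
        rw [n1, n2]
        have : ∃ x, ∀ y, y ∈ e.2.ends ∧ y ∈ e'.2.ends ↔ y = x := by
          generalize e.2 = i at *
          generalize e'.2 = j at *
          cases i <;> cases j <;> first
            | exact absurd rfl hee
            | (refine ⟨0, ?_⟩; intro y; fin_cases y <;> simp [K3Edge.ends]; done)
            | (refine ⟨1, ?_⟩; intro y; fin_cases y <;> simp [K3Edge.ends]; done)
            | (refine ⟨2, ?_⟩; intro y; fin_cases y <;> simp [K3Edge.ends])
        obtain ⟨x, hx⟩ := this
        exact ⟨x, by ext y; simpa using hx y⟩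
      · rintro _ ⟨_, ((rfl | rfl) | (rfl | rfl)), rfl⟩ <;> assumption
    have F6 : ∀ e f g h, some e ∈ I → some f ∈ I → some g ∈ I → some h ∈ I → e ≠ f → e.2 = f.2 →
        g.2 ≠ e.2 → h.2 ≠ e.2 → g.2 = h.2 := by
      intro e f g h he hf hg hh hne hef hge hhe
      by_contra hgh
      have hsub : (some '' {e, f, g, h} : Set (Option (Q × K3Edge))) ⊆ I := by
        rintro _ ⟨_, (rfl | rfl | rfl | rfl), rfl⟩ <;> assumption
      refine hI _ (.theta _ (expansion_isTheta_four hne hef hge hhe hgh) ?_) hsub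
      rintro C hC hCb
      exact hI _ (.balanced C hCb) ((Set.image_mono hC).trans hsub)
    refine ⟨?_, ?_⟩
    · by_contra! h3
      have h4 : (4 : ℕ∞) ≤ I.encard := by
        have := Order.add_one_le_of_lt h3
        norm_num at this
        exact this
      obtain ⟨J, hJI, hJ⟩ := Set.exists_subset_encard_eq h4
      obtain ⟨a, b, c, d, hab, hac, had, hbc, hbd, hcd, rfl⟩ := Set.encard_eq_four.1 hJ
      have ma : a ∈ I := hJI (by simp)
      have mb : b ∈ I := hJI (by simp)
      have mc : c ∈ I := hJI (by simp)
      have md : d ∈ I := hJI (by simp)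
      have htri : ∀ i j k l : K3Edge, i = j ∨ i = k ∨ j = k ∨ i = l ∨ j = l ∨ k = l := by
        intro i j k l
        cases i <;> cases j <;> cases k <;> simp <;> cases l <;> simp
      have H3 : ∀ e f g : Q × K3Edge, none ∈ I → some e ∈ I → some f ∈ I → some g ∈ I → e ≠ f →
          e ≠ g → f ≠ g → False := by
        intro e f g h0 he hf hg h1 h2 h3
        exact F4 e f g h0 he hf hg (fun h => h1 (F1 _ _ h0 he hf h))
          (fun h => h2 (F1 _ _ h0 he hg h)) (fun h => h3 (F1 _ _ h0 hf hg h))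
      have H4 : ∀ e f g h : Q × K3Edge, some e ∈ I → some f ∈ I → some g ∈ I → some h ∈ I →
          e ≠ f → e ≠ g → e ≠ h → f ≠ g → f ≠ h → g ≠ h → e.2 = f.2 → False := by
        intro e f g h he hf hg hh h1 h2 h3 h4 h5 h6 h7
        have hge : g.2 ≠ e.2 := fun hh' => by
          have := F2 e f g he hf hg h7 hh'.symm
          tauto
        have hhe : h.2 ≠ e.2 := fun hh' => by
          have := F2 e f h he hf hh h7 hh'.symm
          tauto
        have hgh := F6 e f g h he hf hg hh h1 h7 hge hhe
        exact hge (F5 e f g h he hf hg hh h1 h6 h7 hgh).symm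
      rcases a with _ | a
      · rcases b with _ | b
        · exact hab rfl
        rcases c with _ | c
        · exact hac rfl
        rcases d with _ | d
        · exact had rfl
        exact H3 b c d ma mb mc md (by simpa using hbc) (by simpa using hbd) (by simpa using hcd)
      rcases b with _ | b
      · rcases c with _ | c
        · exact hbc rfl
        rcases d with _ | d
        · exact hbd rfl
        exact H3 a c d mb ma mc md (by simpa using hac) (by simpa using had) (by simpa using hcd)
      rcases c with _ | c
      · rcases d with _ | d
        · exact hcd rfl
        exact H3 a b d mc ma mb md (by simpa using hab) (by simpa using had) (by simpa using hbd)
      rcases d with _ | d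
      · exact H3 a b c md ma mb mc (by simpa using hab) (by simpa using hac) (by simpa using hbc)
      rw [Ne, Option.some_inj] at hab hac had hbc hbd hcd
      obtain h | h | h | h | h | h := htri a.2 b.2 c.2 d.2
      · exact H4 a b c d ma mb mc md hab hac had hbc hbd hcd h
      · exact H4 a c b d ma mc mb md hac hab had (Ne.symm hbc) hcd hbd h
      · exact H4 b c a d mb mc ma md hbc (Ne.symm hab) hbd (Ne.symm hac) hcd had h
      · exact H4 a d b c ma md mb mc had hab hac (Ne.symm hbd) (Ne.symm hcd) hbc h
      · exact H4 b d a c mb md ma mc hbd (Ne.symm hab) hbc (Ne.symm had) (Ne.symm hcd) hac h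
      · exact H4 c d a b mc md ma mb hcd (Ne.symm hac) (Ne.symm hbc) (Ne.symm had) (Ne.symm hbd)
          hab h
    · rintro l (⟨i, rfl⟩ | ⟨_, ⟨g, h, k, hg, rfl⟩, rfl⟩) hIl
      · by_contra! h2
        have h3 : (3 : ℕ∞) ≤ I.encard := by
          have := Order.add_one_le_of_lt h2
          norm_num at this
          exact this
        obtain ⟨J, hJI, hJ⟩ := Set.exists_subset_encard_eq h3
        obtain ⟨a, b, c, hab, hac, hbc, rfl⟩ := Set.encard_eq_three.1 hJ
        have ma : a ∈ I := hJI (by simp)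
        have mb : b ∈ I := hJI (by simp)
        have mc : c ∈ I := hJI (by simp)
        have la := hIl ma
        have lb := hIl mb
        have lc := hIl mc
        simp at la lb lc
        grind
      · by_contra! h2
        have hT : (some '' {(g, .e12), (h, .e23), (k, .e13)} : Set (Option (Q × K3Edge))).encard
            ≤ I.encard := by
          rw [hsome.encard_image]
          refine le_trans (Set.encard_insert_le _ _) ?_
          rw [Set.encard_pair (by simp)]
          exact Order.add_one_le_of_lt h2
        have hfin : (some '' {(g, .e12), (h, .e23), (k, .e13)} :
            Set (Option (Q × K3Edge))).Finite := Set.toFinite _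
        have := (hfin.subset hIl).eq_of_subset_of_encard_le hIl hT
        subst this
        exact F3 g h k (by simp) (by simp) (by simp) hg
  · intro hI C hC hCI
    refine absurd (hI.subset hCI) ?_
    clear hI hCI
    cases hC with
    | balanced C hC =>
      obtain ⟨g, h, k, hg, rfl⟩ := hC
      refine not3 (l := _) ?_ (Or.inr ⟨_, ⟨g, h, k, hg, rfl⟩, rfl⟩) subset_rfl
      rw [hsome.encard_image, Set.encard_insert_of_notMem (by simp), Set.encard_pair (by simp)]
      norm_num
    | theta T hT _ =>
      obtain ⟨h3, i, -, h | h⟩ := expansion_isTheta_cases hT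
      · refine not3 (by rwa [hsome.encard_image]) (Or.inl ⟨i, rfl⟩) ?_
        rintro _ ⟨e, he, rfl⟩
        exact Or.inr ⟨e, h e he, rfl⟩
      · exact not4 (by rwa [hsome.encard_image])
    | joined C D hC hD _ _ h =>
      refine not4 ?_
      rw [hsome.encard_image]
      refine hodd C D hC hD ?_
      obtain ⟨x, hx⟩ := h
      intro y z hy hy' hz hz'
      have e1 : y ∈ ({x} : Set (Fin 3)) := hx ▸ ⟨hy, hy'⟩
      have e2 : z ∈ ({x} : Set (Fin 3)) := hx ▸ ⟨hz, hz'⟩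
      exact e1.trans e2.symm
    | disjoint C D hC hD _ _ h =>
      refine not4 ?_
      rw [hsome.encard_image]
      refine hodd C D hC hD ?_
      intro y z hy hy' hz hz'
      have e1 : y ∈ (∅ : Set (Fin 3)) := h ▸ ⟨hy, hy'⟩
      exact e1.elim
    | extra C hC _ =>
      obtain ⟨i, g, g', hne, rfl⟩ | ⟨g, h, k, rfl⟩ := expansion_isCircle_cases hC
      · refine not3 ?_ (Or.inl ⟨i, rfl⟩) ?_
        · rw [Set.encard_insert_of_notMem (by simp), hsome.encard_image,
            Set.encard_pair (by simpa using hne)]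
          norm_num
        · rintro _ (rfl | ⟨_, (rfl | rfl), rfl⟩) <;> simp
      · refine not4 ?_
        rw [Set.encard_insert_of_notMem (by simp), hsome.encard_image,
          Set.encard_insert_of_notMem (by simp), Set.encard_pair (by simp)]
        norm_num

end liftLemmas

/-- The extended lift matroid `L₀(Q K₃)` on the edges `some e` and the extra element `none`: its
independent sets are the sets that contain no lift circuit. -/
def extendedLiftMatroid {Q : Type*} (op : Q → Q → Q) (hop : IsQuasigroup op) :
    Matroid (Option (Q × K3Edge)) :=
  Matroid.ofExistsMatroid Set.univ (quasigroupExpansion op hop).LiftIndep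
    ⟨lineMatroid (liftLines op) (liftLines_unique hop), rfl, fun I => by
      rw [lineMatroid_indep_iff, expansion_liftIndep_iff]⟩

/-- The lift matroid `L(Q K₃) = L₀(Q K₃) \ e₀`, as a matroid on the set of edges. -/
def liftMatroid {Q : Type*} (op : Q → Q → Q) (hop : IsQuasigroup op) : Matroid (Q × K3Edge) :=
  (extendedLiftMatroid op hop).comap some

/-! ### Embeddings in a projective plane -/

/-- `f` is an injection of the ground set of `M` into the ground set of `N` that preserves
independence and dependence. -/
def Matroid.IsEmbedding {α β : Type*} (M : Matroid α) (N : Matroid β) (f : α → β) : Prop :=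
  Set.InjOn f M.E ∧ Set.MapsTo f M.E N.E ∧ ∀ I ⊆ M.E, M.Indep I ↔ N.Indep (f '' I)

section Embeddings

variable (P L : Type*) [Membership P L] [Configuration.ProjectivePlane P L]

/-- The matroid of the lines of a projective plane: its matroid as a set of points of the dual
plane. -/
def lineSetMatroid : Matroid L :=
  planeMatroid (Configuration.Dual L) (Configuration.Dual P)

/-- `M` embeds as points in the projective plane `(P, L)`. -/
def EmbedsAsPoints {α : Type*} (M : Matroid α) : Prop :=
  ∃ f : α → P, M.IsEmbedding (planeMatroid P L) f

/-- `M` embeds as lines in the projective plane `(P, L)`. -/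
def EmbedsAsLines {α : Type*} (M : Matroid α) : Prop :=
  ∃ f : α → L, M.IsEmbedding (lineSetMatroid P L) f

end Embeddings

/-- The set `A` of points is a dual 3-net with main lines `m`. -/
structure IsDualThreeNet {P L : Type*} [Membership P L] (m : K3Edge → L) (A : Set P) : Prop where
  main_injective : Function.Injective m
  mem_main : ∀ p ∈ A, ∃ i, p ∈ m i
  notMem_two : ∀ p ∈ A, ∀ i j, i ≠ j → p ∈ m i → p ∉ m j
  cross : ∀ i j k, i ≠ j → i ≠ k → j ≠ k → ∀ p ∈ A, ∀ q ∈ A, p ∈ m i → q ∈ m j →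
    ∀ l : L, p ∈ l → q ∈ l → ∃ r ∈ A, r ∈ l ∧ r ∈ m k

/-- The set `B` of lines, with the intersection points of its members other than the centers `c`,
is a 3-net (regularly) embedded in the plane. -/
structure IsThreeNet {P L : Type*} [Membership P L] (c : K3Edge → P) (B : Set L) : Prop where
  center_injective : Function.Injective c
  center_mem : ∀ l ∈ B, ∃! i, c i ∈ l
  three_lines : ∀ l ∈ B, ∀ l' ∈ B, l ≠ l' → ∀ p, p ∈ l → p ∈ l' → (∀ i, p ≠ c i) →
    {l'' | l'' ∈ B ∧ p ∈ l''}.encard = 3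
  notMem_span : ∀ l ∈ B, ∀ l' ∈ B, l ≠ l' → ∀ p, p ∈ l → p ∈ l' → (∀ i, p ≠ c i) →
    ∀ i j, i ≠ j → ∀ n : L, c i ∈ n → c j ∈ n → p ∉ n

section NetEmbeddings

variable (P L : Type*) [Membership P L] [Configuration.ProjectivePlane P L]

/-- A matroid on the edges of an expansion of the triangle embeds as a dual affine 3-net: it embeds
as points, the image is a dual 3-net with concurrent main lines, and each parallel class of edges is
mapped into its own main line. -/
def EmbedsAsDualAffineThreeNet {Q : Type*} (M : Matroid (Q × K3Edge)) : Prop :=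
  ∃ (f : Q × K3Edge → P) (m : K3Edge → L), M.IsEmbedding (planeMatroid P L) f ∧
    IsDualThreeNet m (Set.range f) ∧ (∀ e, f e ∈ m e.2) ∧ ∃ p, ∀ i, p ∈ m i

/-- A matroid on the edges of an expansion of the triangle embeds as an affine 3-net: it embeds as
lines, the image is a 3-net with collinear centers, and each parallel class of edges is mapped to
lines through its own center. -/
def EmbedsAsAffineThreeNet {Q : Type*} (M : Matroid (Q × K3Edge)) : Prop :=
  ∃ (f : Q × K3Edge → L) (c : K3Edge → P), M.IsEmbedding (lineSetMatroid P L) f ∧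
    IsThreeNet c (Set.range f) ∧ (∀ e, c e.2 ∈ f e) ∧ ∃ l : L, ∀ i, c i ∈ l

end NetEmbeddings

/-! All the conditions describe one configuration: three lines through a point z, each carrying a
copy of Q that avoids z, such that the points labelled g, h, k on the three lines are collinear
exactly when g · h = k (`IsPencilRealization`).

Matroid side. The extended lift matroid is the rank three geometry whose lines are the parallel
classes with e₀ added and the balanced triangles. An embedding is therefore an injection that
preserves and reflects collinearity of triples (`Matroid.HasLineFamily.isEmbedding_iff`). Embedding
e₀ fixes z, and each main line is spanned by z and one point of its class. Without e₀, the point z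
comes from the concurrency of the main lines of the net. The statements about lines of the dual
plane are the same statements read in the double dual.

Algebraic side. In the plane of a ternary ring the points [a], [0, b], [1, c] lie on three lines
through the vertical point, and they are collinear exactly when c = t(1, a, b) = a + b. So each
subquasigroup of the additive loop gives a configuration. Isotopy relabels the points on each line
separately and conjugation permutes the three lines, so isostrophic operations are realized in the
same planes.

Conversely, let Q be a loop with identity e. Take the three lines as the line at infinity, x = 0 and
x = 1, and the points labelled e on the first two as slope 0 and origin; such a choice always
extends to coordinates (`exists_coordinateFrame`). Collinearity then says α(g) + β(h) = γ(g · h).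
Since α(e) = β(e) = 0, putting g = e or h = e gives α = β = γ, an isomorphism onto a subloop
(`HasPencilRealization.exists_subloop`). A general quasigroup is first replaced by an isotopic loop.
-/

/-! ### Incidence in a projective plane -/

section Geometry

open Configuration

variable {P L : Type*} [Membership P L] [ProjectivePlane P L]

theorem exists_line_through (p q : P) : ∃ l : L, p ∈ l ∧ q ∈ l := by
  by_cases h : p = q
  · subst h
    obtain ⟨-, p₂, -, -, l₂, -, -, -, -, h₂, -⟩ := ProjectivePlane.exists_config (P := P) (L := L)
    by_cases h : p = p₂
    · exact ⟨l₂, h ▸ h₂, h ▸ h₂⟩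
    · exact ⟨_, (HasLines.mkLine_ax h).1, (HasLines.mkLine_ax h).1⟩
  · exact ⟨_, HasLines.mkLine_ax h⟩

theorem exists_point_on (l m : L) : ∃ p : P, p ∈ l ∧ p ∈ m :=
  exists_line_through (P := Dual L) (L := Dual P) l m

theorem line_eq {p q : P} {l m : L} (h : p ≠ q) (hpl : p ∈ l) (hql : q ∈ l) (hpm : p ∈ m)
    (hqm : q ∈ m) : l = m :=
  (Nondegenerate.eq_or_eq hpl hql hpm hqm).resolve_left h

theorem point_eq {p q : P} {l m : L} (h : l ≠ m) (hpl : p ∈ l) (hql : q ∈ l) (hpm : p ∈ m)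
    (hqm : q ∈ m) : p = q :=
  (Nondegenerate.eq_or_eq hpl hql hpm hqm).resolve_right h

variable (L) in
/-- A line through two given points. -/
noncomputable def join (p q : P) : L := (exists_line_through p q).choose

variable (P) in
/-- A common point of two given lines. -/
noncomputable def meet (l m : L) : P := (exists_point_on l m).choose

theorem left_mem_join (p q : P) : p ∈ join L p q := (exists_line_through p q).choose_spec.1
theorem right_mem_join (p q : P) : q ∈ join L p q := (exists_line_through p q).choose_spec.2
theorem meet_mem_left (l m : L) : meet P l m ∈ l := (exists_point_on l m).choose_spec.1
theorem meet_mem_right (l m : L) : meet P l m ∈ m := (exists_point_on l m).choose_spec.2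

/-- Projection from `p` is injective: the three lines cut `l` in three different points, and at
least one of them avoids `x` and `y`. With the dual `exists_three_lines`, this carries triples of
points from one line to another. -/
theorem exists_third_point_of_lines {p : P} {l a b c : L} (hpl : p ∉ l) (ha : p ∈ a) (hb : p ∈ b)
    (hc : p ∈ c) (hab : a ≠ b) (hac : a ≠ c) (hbc : b ≠ c) (x y : P) :
    ∃ q ∈ l, q ≠ x ∧ q ≠ y := by
  have key : ∀ {a b : L}, p ∈ a → p ∈ b → a ≠ b → meet P l a ≠ meet P l b := by
    intro a b ha hb hab h
    have := point_eq hab ha (meet_mem_right l a) hb (h ▸ meet_mem_right l b)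
    exact hpl (this ▸ meet_mem_left l a)
  have h1 := key ha hb hab
  have h2 := key ha hc hac
  have h3 := key hb hc hbc
  have m1 := meet_mem_left (P := P) l a
  have m2 := meet_mem_left (P := P) l b
  have m3 := meet_mem_left (P := P) l c
  grind

theorem exists_three_lines {p : P} {l : L} (hpl : p ∉ l) {x y w : P} (hx : x ∈ l) (hy : y ∈ l)
    (hw : w ∈ l) (hxy : x ≠ y) (hxw : x ≠ w) (hyw : y ≠ w) :
    ∃ a b c : L, p ∈ a ∧ p ∈ b ∧ p ∈ c ∧ a ≠ b ∧ a ≠ c ∧ b ≠ c := by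
  have key : ∀ {x y : P}, x ∈ l → y ∈ l → x ≠ y → join L p x ≠ join L p y := by
    intro x y hx hy hxy h
    have := line_eq hxy hx hy (right_mem_join p x) (h ▸ right_mem_join p y)
    exact hpl (this ▸ left_mem_join p x)
  exact ⟨_, _, _, left_mem_join _ x, left_mem_join _ y, left_mem_join _ w, key hx hy hxy,
    key hx hw hxw, key hy hw hyw⟩

/-- The nondegenerate configuration supplies three lines through `p₂`, hence three points on `l₁`.
Any other line receives three points by projection from a point off both lines. -/
theorem exists_third_point (l : L) (x y : P) : ∃ q ∈ l, q ≠ x ∧ q ≠ y := by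
  obtain ⟨p₁, p₂, p₃, l₁, l₂, l₃, h₁₂, h₁₃, h₂₁, h₂₂, h₂₃, h₃₁, h₃₂, h₃₃⟩ :=
    ProjectivePlane.exists_config (P := P) (L := L)
  have n₂₃ : l₂ ≠ l₃ := by rintro rfl; exact h₃₃ h₃₂
  have third : ∀ x y : P, ∃ q ∈ l₁, q ≠ x ∧ q ≠ y := by
    refine exists_third_point_of_lines h₂₁ h₂₂ h₂₃ (right_mem_join p₁ p₂) n₂₃ ?_ ?_ <;>
    · rintro rfl
      have := left_mem_join (L := L) p₁ p₂
      contradiction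
  have step : ∀ {p : P} {l : L}, p ∉ l₁ → p ∉ l → ∀ x y : P, ∃ q ∈ l, q ≠ x ∧ q ≠ y := by
    intro p l hp1 hpl
    obtain ⟨x, hx, -⟩ := third p p
    obtain ⟨y, hy, hyx, -⟩ := third x x
    obtain ⟨w, hw, hwx, hwy⟩ := third x y
    obtain ⟨a, b, c, ha, hb, hc, hab, hac, hbc⟩ :=
      exists_three_lines hp1 hx hy hw hyx.symm hwx.symm hwy.symm
    exact exists_third_point_of_lines hpl ha hb hc hab hac hbc
  by_cases h2 : p₂ ∈ l
  · by_cases h3 : p₃ ∈ l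
    · obtain rfl : l = l₂ := line_eq (by rintro rfl; exact h₃₃ h₂₃) h2 h3 h₂₂ h₃₂
      by_cases h1 : p₁ ∈ l₁
      -- Here `l = l₂` and `p₁ ∈ l₁`, so none of the given points is a center. The line `p₁p₃` meets
      -- `l₁` only in `p₁` and `l` only in `p₃`, and neither is on `l₃`; so its intersection with
      -- `l₃` is off both lines.
      · have m1 := left_mem_join (L := L) p₁ p₃
        have m3 := right_mem_join (L := L) p₁ p₃
        have q1 := meet_mem_left (P := P) l₃ (join L p₁ p₃)
        have q2 := meet_mem_right (P := P) l₃ (join L p₁ p₃)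
        refine step (p := meet P l₃ (join L p₁ p₃)) (fun h => ?_) (fun h => ?_) x y
        · have := point_eq (by rintro rfl; exact h₃₁ m3) h h1 q2 m1
          exact h₁₃ (this ▸ q1)
        · have := point_eq (by rintro rfl; exact h₁₂ m1) h h₃₂ q2 m3
          exact h₃₃ (this ▸ q1)
      · exact step h1 h₁₂ x y
    · exact step h₃₁ h3 x y
  · exact step h₂₁ h2 x y

end Geometry

/-! ### Coordinate frames and their ternary rings -/

section Frames

open Configuration

/-- Coordinates in a projective plane: `V x` and `H y` are the lines with equations `x = const` and
`y = const`, which meet the line at infinity `Z` in `z` and `s`, and `S m` is the point at infinity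
of the lines with slope `m`. -/
structure CoordinateFrame (P L : Type*) [Membership P L] (R : Type*) where
  z : P
  s : P
  Z : L
  V : R → L
  H : R → L
  S : R → P
  zero : R
  one : R
  z_mem : z ∈ Z
  s_mem : s ∈ Z
  s_ne : s ≠ z
  mem_V : ∀ x, z ∈ V x
  V_ne : ∀ x, V x ≠ Z
  V_injective : Function.Injective V
  V_surjective : ∀ l, z ∈ l → l ≠ Z → ∃ x, V x = l
  mem_H : ∀ y, s ∈ H y
  H_ne : ∀ y, H y ≠ Z
  H_injective : Function.Injective H
  H_surjective : ∀ l, s ∈ l → l ≠ Z → ∃ y, H y = l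
  S_mem : ∀ m, S m ∈ Z
  S_ne : ∀ m, S m ≠ z
  S_injective : Function.Injective S
  S_surjective : ∀ p, p ∈ Z → p ≠ z → ∃ m, S m = p
  zero_ne_one : zero ≠ one
  S_zero : S zero = s
  -- The line of slope a through the origin passes through (1, a), which is t(1, a, 0) = a; in
  -- `diagonal`, the line of slope 1 through the origin passes through (a, a), which is t(a, 1, 0) =
  -- a.
  S_eq : ∀ a, ∃ (o q : P) (l : L), o ∈ V zero ∧ o ∈ H zero ∧ q ∈ V one ∧ q ∈ H a ∧ o ∈ l ∧
    S a ∈ l ∧ q ∈ l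
  diagonal : ∀ a, ∃ (o q : P) (l : L), o ∈ V zero ∧ o ∈ H zero ∧ q ∈ V a ∧ q ∈ H a ∧ o ∈ l ∧
    S one ∈ l ∧ q ∈ l

namespace CoordinateFrame

variable {P L R : Type*} [Membership P L] [ProjectivePlane P L] (F : CoordinateFrame P L R)

/-- The point with coordinates `x` and `y`. -/
noncomputable def pt (x y : R) : P := meet P (F.V x) (F.H y)

/-- The line with slope `m` and intercept `k`. -/
noncomputable def ln (m k : R) : L := join L (F.S m) (F.pt F.zero k)

theorem V_ne_H (x y : R) : F.V x ≠ F.H y := fun h =>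
  F.V_ne x (line_eq F.s_ne (h ▸ F.mem_H y) (F.mem_V x) F.s_mem F.z_mem)

theorem pt_mem_V (x y : R) : F.pt x y ∈ F.V x := meet_mem_left _ _

theorem pt_mem_H (x y : R) : F.pt x y ∈ F.H y := meet_mem_right _ _

theorem eq_pt {p : P} {x y : R} (h : p ∈ F.V x) (h' : p ∈ F.H y) : p = F.pt x y :=
  point_eq (F.V_ne_H x y) h (F.pt_mem_V x y) h' (F.pt_mem_H x y)

theorem pt_notMem (x y : R) : F.pt x y ∉ F.Z := by
  intro h
  have h1 := point_eq (F.V_ne x) (F.pt_mem_V x y) (F.mem_V x) h F.z_mem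
  have h2 := point_eq (F.H_ne y) (F.pt_mem_H x y) (F.mem_H y) h F.s_mem
  exact F.s_ne (h2.symm.trans h1)

theorem exists_eq_V {p : P} (hp : p ∉ F.Z) : ∃ x, p ∈ F.V x := by
  obtain ⟨x, hx⟩ := F.V_surjective (join L F.z p) (left_mem_join _ _)
    (fun h => hp (h ▸ right_mem_join _ _))
  exact ⟨x, hx ▸ right_mem_join _ _⟩

theorem exists_eq_H {p : P} (hp : p ∉ F.Z) : ∃ y, p ∈ F.H y := by
  obtain ⟨y, hy⟩ := F.H_surjective (join L F.s p) (left_mem_join _ _)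
    (fun h => hp (h ▸ right_mem_join _ _))
  exact ⟨y, hy ▸ right_mem_join _ _⟩

theorem pt_mem_V_iff {x y x' : R} : F.pt x y ∈ F.V x' ↔ x = x' := by
  refine ⟨fun h => F.V_injective ?_, fun h => h ▸ F.pt_mem_V x y⟩
  exact line_eq (fun (h' : F.pt x y = F.z) => F.pt_notMem x y (h' ▸ F.z_mem)) (F.pt_mem_V x y)
    (F.mem_V x) h (F.mem_V x')

theorem pt_mem_H_iff {x y y' : R} : F.pt x y ∈ F.H y' ↔ y = y' := by
  refine ⟨fun h => F.H_injective ?_, fun h => h ▸ F.pt_mem_H x y⟩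
  exact line_eq (fun (h' : F.pt x y = F.s) => F.pt_notMem x y (h' ▸ F.s_mem)) (F.pt_mem_H x y)
    (F.mem_H y) h (F.mem_H y')

theorem exists_eq_pt {p : P} (hp : p ∉ F.Z) : ∃ x y, p = F.pt x y := by
  obtain ⟨x, hx⟩ := F.exists_eq_V hp
  obtain ⟨y, hy⟩ := F.exists_eq_H hp
  exact ⟨x, y, F.eq_pt hx hy⟩

theorem pt_inj {x y x' y' : R} : F.pt x y = F.pt x' y' ↔ x = x' ∧ y = y' := by
  refine ⟨fun h => ⟨?_, ?_⟩, by rintro ⟨rfl, rfl⟩; rfl⟩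
  · rw [← F.pt_mem_V_iff, h]
    exact F.pt_mem_V x' y'
  · rw [← F.pt_mem_H_iff, h]
    exact F.pt_mem_H x' y'

theorem S_mem_ln (m k : R) : F.S m ∈ F.ln m k := left_mem_join _ _

theorem pt_zero_mem_ln (m k : R) : F.pt F.zero k ∈ F.ln m k := right_mem_join _ _

theorem eq_ln {l : L} {m k : R} (h : F.S m ∈ l) (h' : F.pt F.zero k ∈ l) : l = F.ln m k :=
  line_eq (fun (e : F.S m = F.pt F.zero k) => F.pt_notMem F.zero k (e ▸ F.S_mem m)) h h'
    (F.S_mem_ln m k) (F.pt_zero_mem_ln m k)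

theorem ln_ne (m k : R) : F.ln m k ≠ F.Z := fun h =>
  F.pt_notMem _ _ (h ▸ F.pt_zero_mem_ln m k)

theorem S_mem_ln_iff {m m' k : R} : F.S m ∈ F.ln m' k ↔ m = m' := by
  refine ⟨fun h => F.S_injective ?_, fun h => h ▸ F.S_mem_ln m k⟩
  exact point_eq (F.ln_ne m' k) h (F.S_mem_ln m' k) (F.S_mem m) (F.S_mem m')

theorem z_notMem_ln (m k : R) : F.z ∉ F.ln m k := fun h =>
  F.S_ne m (point_eq (F.ln_ne m k) (F.S_mem_ln m k) h (F.S_mem m) F.z_mem)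

theorem exists_S_mem {l : L} (hl : F.z ∉ l) : ∃ m, F.S m ∈ l := by
  obtain ⟨m, hm⟩ := F.S_surjective (meet P F.Z l) (meet_mem_left _ _)
    (fun h => hl (h ▸ meet_mem_right _ _))
  exact ⟨m, hm ▸ meet_mem_right _ _⟩

/-- This makes the ternary operation well defined: `F.V x` meets infinity only in `F.z`, which is
not on `l`, so its intersection with `l` is an affine point. -/
theorem existsUnique_pt_mem {l : L} (hl : F.z ∉ l) (x : R) : ∃! y, F.pt x y ∈ l := by
  have h1 := meet_mem_left (P := P) (F.V x) l
  have h2 := meet_mem_right (P := P) (F.V x) l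
  obtain ⟨x', y, hxy⟩ := F.exists_eq_pt (p := meet P (F.V x) l) fun h => by
    have := point_eq (F.V_ne x) h1 (F.mem_V x) h F.z_mem
    exact hl (this ▸ h2)
  rw [hxy] at h1 h2
  obtain rfl := F.pt_mem_V_iff.1 h1
  refine ⟨y, h2, fun y' hy' => ?_⟩
  have := point_eq (fun (h : F.V x' = l) => hl (h ▸ F.mem_V x')) h1 (F.pt_mem_V x' y') h2 hy'
  exact (F.pt_inj.1 this).2.symm

theorem exists_eq_ln {l : L} (hl : F.z ∉ l) : ∃ m k, l = F.ln m k := by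
  obtain ⟨m, hm⟩ := F.exists_S_mem hl
  obtain ⟨k, hk, -⟩ := F.existsUnique_pt_mem hl F.zero
  exact ⟨m, k, F.eq_ln hm hk⟩

theorem ln_inj {m k m' k' : R} : F.ln m k = F.ln m' k' ↔ m = m' ∧ k = k' := by
  refine ⟨fun h => ⟨?_, ?_⟩, by rintro ⟨rfl, rfl⟩; rfl⟩
  · exact F.S_mem_ln_iff.1 (h ▸ F.S_mem_ln m k)
  · exact (F.existsUnique_pt_mem (F.z_notMem_ln m k) F.zero).unique (F.pt_zero_mem_ln m k)
      (h ▸ F.pt_zero_mem_ln m' k')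

/-- The second coordinate of the point with first coordinate `x` on the line with slope `m` and
intercept `k`. -/
noncomputable def ternary (x m k : R) : R :=
  (F.existsUnique_pt_mem (F.z_notMem_ln m k) x).choose

theorem pt_mem_ln_iff {x y m k : R} : F.pt x y ∈ F.ln m k ↔ F.ternary x m k = y := by
  have h := (F.existsUnique_pt_mem (F.z_notMem_ln m k) x).choose_spec
  exact ⟨fun h' => (h.2 y h').symm, fun h' => h' ▸ h.1⟩

/-- The ternary ring of a coordinate frame. -/
noncomputable def ternaryRing {P L : Type*} {R : Type u} [Membership P L] [ProjectivePlane P L]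
    (F : CoordinateFrame P L R) : TernaryRing R where
  t := F.ternary
  zero := F.zero
  one := F.one
  -- The three solvability axioms are three incidence facts: lines of different slopes meet in an
  -- affine point, an affine point has one line of each slope through it, and affine points with
  -- different first coordinates have a nonvertical join.
  existsUnique_left a b c d hac := by
    have hne : F.ln a b ≠ F.ln c d := fun h => hac (F.ln_inj.1 h).1
    have h1 := meet_mem_left (P := P) (F.ln a b) (F.ln c d)
    have h2 := meet_mem_right (P := P) (F.ln a b) (F.ln c d)
    obtain ⟨x, y, hxy⟩ := F.exists_eq_pt (p := meet P (F.ln a b) (F.ln c d)) fun h => by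
      have := point_eq (F.ln_ne a b) (F.S_mem_ln a b) h1 (F.S_mem a) h
      exact hac (F.S_mem_ln_iff.1 (this ▸ h2))
    rw [hxy] at h1 h2
    refine ⟨x, (F.pt_mem_ln_iff.1 h1).trans (F.pt_mem_ln_iff.1 h2).symm, fun x' hx' => ?_⟩
    have := point_eq hne h1 (F.pt_mem_ln_iff.2 rfl) h2 (F.pt_mem_ln_iff.2 hx'.symm)
    exact (F.pt_inj.1 this).1.symm
  existsUnique_right a b c := by
    have h1 := left_mem_join (L := L) (F.S b) (F.pt a c)
    have h2 := right_mem_join (L := L) (F.S b) (F.pt a c)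
    obtain ⟨m, k, hl⟩ := F.exists_eq_ln (l := join L (F.S b) (F.pt a c)) fun h => by
      have := line_eq (F.S_ne b) h1 h (F.S_mem b) F.z_mem
      exact F.pt_notMem a c (this ▸ h2)
    rw [hl] at h1 h2
    obtain rfl := F.S_mem_ln_iff.1 h1
    refine ⟨k, F.pt_mem_ln_iff.1 h2, fun k' hk' => ?_⟩
    have := line_eq (fun (e : F.S b = F.pt a c) => F.pt_notMem a c (e ▸ F.S_mem b)) h1 h2
      (F.S_mem_ln b k') (F.pt_mem_ln_iff.2 hk')
    exact (F.ln_inj.1 this).2.symm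
  existsUnique_pair a b c d hac := by
    have h1 := left_mem_join (L := L) (F.pt a b) (F.pt c d)
    have h2 := right_mem_join (L := L) (F.pt a b) (F.pt c d)
    obtain ⟨m, k, hl⟩ := F.exists_eq_ln (l := join L (F.pt a b) (F.pt c d)) fun h => by
      have := line_eq (fun (e : F.pt a b = F.z) => F.pt_notMem a b (e ▸ F.z_mem)) h1 h
        (F.pt_mem_V a b) (F.mem_V a)
      exact hac (F.pt_mem_V_iff.1 (this ▸ h2)).symm
    rw [hl] at h1 h2
    refine ⟨(m, k), ⟨F.pt_mem_ln_iff.1 h1, F.pt_mem_ln_iff.1 h2⟩, fun p hp => ?_⟩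
    have := line_eq (fun e => hac (F.pt_inj.1 e).1) h1 h2 (F.pt_mem_ln_iff.2 hp.1)
      (F.pt_mem_ln_iff.2 hp.2)
    exact Prod.ext (F.ln_inj.1 this).1.symm (F.ln_inj.1 this).2.symm
  zero_ne_one := F.zero_ne_one
  t_zero_left a b := F.pt_mem_ln_iff.1 (F.pt_zero_mem_ln a b)
  t_zero_middle a b := by
    -- Since slope zero is the point `F.s`, the lines of slope zero are the horizontals.
    rw [← F.pt_mem_ln_iff, ← F.eq_ln (l := F.H b) (F.S_zero ▸ F.mem_H b) (F.pt_mem_H _ b)]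
    exact F.pt_mem_H a b
  t_one_left a := by
    obtain ⟨o, q, l, h1, h2, h3, h4, h5, h6, h7⟩ := F.S_eq a
    rw [F.eq_pt h1 h2] at h5
    rwa [F.eq_pt h3 h4, F.eq_ln h6 h5, F.pt_mem_ln_iff] at h7
  t_one_middle a := by
    obtain ⟨o, q, l, h1, h2, h3, h4, h5, h6, h7⟩ := F.diagonal a
    rw [F.eq_pt h1 h2] at h5
    rwa [F.eq_pt h3 h4, F.eq_ln h6 h5, F.pt_mem_ln_iff] at h7

/-- The point with given coordinates. -/
noncomputable def ofPoint : F.ternaryRing.Point → P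
  | .affine x y => F.pt x y
  | .slope m => F.S m
  | .vertical => F.z

/-- The line with given coordinates. -/
noncomputable def ofLine : F.ternaryRing.Line → L
  | .affine m k => F.ln m k
  | .vertical x => F.V x
  | .infinity => F.Z

theorem ofPoint_bijective : Function.Bijective F.ofPoint := by
  constructor
  · have h1 : ∀ x y m, F.pt x y ≠ F.S m := fun x y m e => F.pt_notMem x y (e ▸ F.S_mem m)
    have h2 : ∀ x y, F.pt x y ≠ F.z := fun x y e => F.pt_notMem x y (e ▸ F.z_mem)
    rintro (⟨x, y⟩ | m | _) (⟨x', y'⟩ | m' | _) h <;> simp only [ofPoint] at h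
    · obtain ⟨rfl, rfl⟩ := F.pt_inj.1 h
      rfl
    · exact absurd h (h1 _ _ _)
    · exact absurd h (h2 _ _)
    · exact absurd h.symm (h1 _ _ _)
    · rw [F.S_injective h]
    · exact absurd h (F.S_ne m)
    · exact absurd h.symm (h2 _ _)
    · exact absurd h.symm (F.S_ne _)
    · rfl
  · intro p
    by_cases hp : p ∈ F.Z
    · by_cases hz : p = F.z
      · exact ⟨.vertical, hz.symm⟩
      · obtain ⟨m, rfl⟩ := F.S_surjective p hp hz
        exact ⟨.slope m, rfl⟩
    · obtain ⟨x, y, rfl⟩ := F.exists_eq_pt hp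
      exact ⟨.affine x y, rfl⟩

theorem ofLine_bijective : Function.Bijective F.ofLine := by
  constructor
  · have h1 : ∀ m k x, F.ln m k ≠ F.V x := fun m k x e => F.z_notMem_ln m k (e ▸ F.mem_V x)
    rintro (⟨m, k⟩ | x | _) (⟨m', k'⟩ | x' | _) h <;> simp only [ofLine] at h
    · obtain ⟨rfl, rfl⟩ := F.ln_inj.1 h
      rfl
    · exact absurd h (h1 _ _ _)
    · exact absurd h (F.ln_ne _ _)
    · exact absurd h.symm (h1 _ _ _)
    · rw [F.V_injective h]
    · exact absurd h (F.V_ne x)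
    · exact absurd h.symm (F.ln_ne _ _)
    · exact absurd h.symm (F.V_ne _)
    · rfl
  · intro l
    by_cases hl : F.z ∈ l
    · by_cases hZ : l = F.Z
      · exact ⟨.infinity, hZ.symm⟩
      · obtain ⟨x, rfl⟩ := F.V_surjective l hl hZ
        exact ⟨.vertical x, rfl⟩
    · obtain ⟨m, k, rfl⟩ := F.exists_eq_ln hl
      exact ⟨.affine m k, rfl⟩

theorem ofPoint_mem_ofLine (p : F.ternaryRing.Point) (l : F.ternaryRing.Line) :
    F.ofPoint p ∈ F.ofLine l ↔ F.ternaryRing.Incident p l := by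
  rcases p with ⟨x, y⟩ | m | _ <;> rcases l with ⟨m', k⟩ | x' | _ <;>
    simp only [ofPoint, ofLine, TernaryRing.Incident, iff_false, iff_true]
  · exact F.pt_mem_ln_iff
  · exact F.pt_mem_V_iff
  · exact F.pt_notMem x y
  · exact F.S_mem_ln_iff
  · exact fun h => F.S_ne m (point_eq (F.V_ne x') h (F.mem_V x') (F.S_mem m) F.z_mem)
  · exact F.S_mem m
  · exact F.z_notMem_ln m' k
  · exact F.mem_V x'
  · exact F.z_mem

end CoordinateFrame

/-- Any choice of a line at infinity `Z`, points at infinity `z` and `s` on it, an origin `o` and a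
unit line `V₁` extends to a coordinate system. -/
theorem exists_coordinateFrame {P : Type u} {L : Type v} [Membership P L] [ProjectivePlane P L]
    {z s o : P} {Z V₀ V₁ : L} (hzZ : z ∈ Z) (hz₀ : z ∈ V₀) (hz₁ : z ∈ V₁) (h0 : Z ≠ V₀)
    (h1 : Z ≠ V₁) (h01 : V₀ ≠ V₁) (hs : s ∈ Z) (hsz : s ≠ z) (ho : o ∈ V₀) (hoz : o ≠ z) :
    ∃ (R : Type u) (F : CoordinateFrame P L R), F.z = z ∧ F.s = s ∧ F.Z = Z ∧ F.V F.zero = V₀ ∧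
      F.V F.one = V₁ ∧ o ∈ F.H F.zero := by
  have hoZ : o ∉ Z := fun h => hoz (point_eq h0 h hzZ ho hz₀)
  have ho₁ : o ∉ V₁ := fun h => hoz (point_eq h01 ho hz₀ h hz₁)
  have hs₁ : s ∉ V₁ := fun h => hsz (point_eq h1 hs hzZ h hz₁)
  -- The point `d` becomes the direction of slope 1 and `D` the diagonal y = x; the third point on
  -- `Z` keeps the diagonal from being vertical or horizontal. The affine points of `D` serve as the
  -- coordinates.
  obtain ⟨d, hd, hdz, hds⟩ := exists_third_point Z z s
  obtain ⟨D, hoD, hdD⟩ := exists_line_through (L := L) o d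
  have hDZ : D ≠ Z := by rintro rfl; exact hoZ hoD
  have hzD : z ∉ D := fun h => hdz (point_eq hDZ hdD h hd hzZ)
  have hsD : s ∉ D := fun h => hds (point_eq hDZ hdD h hd hs)
  have m₁ := meet_mem_left (P := P) V₁ D
  have m₂ := meet_mem_right (P := P) V₁ D
  set u : P := meet P V₁ D with hu
  have huZ : u ∉ Z := fun h => by
    have := point_eq h1 h hzZ m₁ hz₁
    exact hzD (this ▸ m₂)
  have hou : o ≠ u := fun h => ho₁ (h ▸ m₁)
  -- `w a` is the point (1, a), on `V₁` at the height of `a`. Its projection `S a` from the origin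
  -- to infinity is the slope required by t(1, a, 0) = a.
  let w : P → P := fun a => meet P V₁ (join L s a)
  let S : P → P := fun a => meet P Z (join L o (w a))
  have hw₁ : ∀ a, w a ∈ V₁ := fun a => meet_mem_left _ _
  have hws : ∀ a, w a ∈ join L s a := fun a => meet_mem_right _ _
  have hwo : ∀ a, o ≠ w a := fun a h => ho₁ (h ▸ hw₁ a)
  have hSZ : ∀ a, S a ∈ Z := fun a => meet_mem_left _ _
  have hSo : ∀ a, S a ∈ join L o (w a) := fun a => meet_mem_right _ _
  have hsa : ∀ a, a ∉ Z → join L s a ≠ Z := fun a ha h => ha (h ▸ right_mem_join _ _)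
  have hza : ∀ a, a ∉ Z → join L z a ≠ Z := fun a ha h => ha (h ▸ right_mem_join _ _)
  have hwZ : ∀ a, a ∉ Z → w a ∉ Z := by
    intro a ha h
    have := point_eq (hsa a ha) (hws a) (left_mem_join s a) h hs
    exact hs₁ (this ▸ hw₁ a)
  have hjo : ∀ a, join L o a ≠ Z := fun a h => hoZ (h ▸ left_mem_join _ _)
  have hsw : ∀ a, s ≠ w a := fun a h => hs₁ (h ▸ hw₁ a)
  have hSz : ∀ a, a ∉ Z → S a ≠ z := by
    intro a ha h
    have h2 : w a ≠ z := fun h => hwZ a ha (h ▸ hzZ)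
    have h3 := line_eq h2 (hw₁ a) hz₁ (right_mem_join o (w a)) (h ▸ hSo a)
    exact ho₁ (h3 ▸ left_mem_join _ _)
  -- The point of `D` with label a is (a, a), so its joins with `z` and `s` are the lines x = a and
  -- y = a. The coordinates form a subtype of `P`, hence a type in its universe.
  refine ⟨{p : P // p ∈ D ∧ p ∉ Z}, {
    z := z
    s := s
    Z := Z
    V := fun x => join L z x
    H := fun y => join L s y
    S := fun a => S a
    zero := ⟨o, hoD, hoZ⟩
    one := ⟨u, m₂, huZ⟩
    z_mem := hzZ
    s_mem := hs
    s_ne := hsz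
    mem_V := fun x => left_mem_join _ _
    V_ne := fun x => hza x x.2.2
    V_injective := ?_
    V_surjective := ?_
    mem_H := fun x => left_mem_join _ _
    H_ne := fun x => hsa x x.2.2
    H_injective := ?_
    H_surjective := ?_
    S_mem := fun a => hSZ a
    S_ne := fun a => hSz a a.2.2
    S_injective := ?_
    S_surjective := ?_
    zero_ne_one := fun h => hou (congrArg Subtype.val h)
    S_zero := ?_
    S_eq := ?_
    diagonal := ?_ }, rfl, rfl, rfl, ?_, ?_, right_mem_join s o⟩
  · rintro ⟨x, hx, hxZ⟩ ⟨y, hy, hyZ⟩ h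
    have h : join L z x = join L z y := h
    refine Subtype.ext (point_eq (l := D) (m := join L z x) ?_ hx hy (right_mem_join _ _)
      (h ▸ right_mem_join _ _))
    rintro h'
    exact hzD (h' ▸ left_mem_join _ _)
  · intro l hzl hlZ
    have a1 := meet_mem_left (P := P) D l
    have a2 := meet_mem_right (P := P) D l
    have hne : meet P D l ≠ z := fun h => hzD (h ▸ a1)
    exact ⟨⟨meet P D l, a1, fun h => hne (point_eq hlZ a2 hzl h hzZ)⟩,
      line_eq hne (right_mem_join _ _) (left_mem_join _ _) a2 hzl⟩
  · rintro ⟨x, hx, hxZ⟩ ⟨y, hy, hyZ⟩ h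
    have h : join L s x = join L s y := h
    refine Subtype.ext (point_eq (l := D) (m := join L s x) ?_ hx hy (right_mem_join _ _)
      (h ▸ right_mem_join _ _))
    rintro h'
    exact hsD (h' ▸ left_mem_join _ _)
  · intro l hzl hlZ
    have a1 := meet_mem_left (P := P) D l
    have a2 := meet_mem_right (P := P) D l
    have hne : meet P D l ≠ s := fun h => hsD (h ▸ a1)
    exact ⟨⟨meet P D l, a1, fun h => hne (point_eq hlZ a2 hzl h hs)⟩,
      line_eq hne (right_mem_join _ _) (left_mem_join _ _) a2 hzl⟩
  · rintro ⟨x, hx, hxZ⟩ ⟨y, hy, hyZ⟩ h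
    have h : S x = S y := h
    have e1 : join L o (w x) = join L o (w y) :=
      line_eq (fun (e : o = S x) => hoZ (e ▸ hSZ x)) (left_mem_join _ _) (hSo x) (left_mem_join _ _)
        (h ▸ hSo y)
    have e2 : w x = w y := point_eq
      (fun (e : V₁ = join L o (w x)) => ho₁ (e ▸ left_mem_join o (w x))) (hw₁ x)
      (hw₁ y) (right_mem_join _ _) (e1 ▸ right_mem_join o (w y))
    have e3 : join L s x = join L s y :=
      line_eq (hsw x) (left_mem_join _ _) (hws x) (left_mem_join _ _) (e2 ▸ hws y)
    refine Subtype.ext (point_eq (l := D) (m := join L s x) ?_ hx hy (right_mem_join _ _)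
      (e3 ▸ right_mem_join _ _))
    rintro h'
    exact hsD (h' ▸ left_mem_join _ _)
  · intro p hp hpz
    -- The construction of the slope is run backwards: project `p` from `o` to `q` on `V₁`, then
    -- project `q` from `s` to `a` on the diagonal.
    have a1 := meet_mem_left (P := P) V₁ (join L o p)
    have a2 := meet_mem_right (P := P) V₁ (join L o p)
    set q := meet P V₁ (join L o p) with hq
    have hpo : o ≠ p := fun e => hoZ (e ▸ hp)
    have hqZ : q ∉ Z := fun h => by
      have e1 := point_eq h1 h hzZ a1 hz₁
      have e2 := point_eq (hjo p) a2 (right_mem_join o p) h hp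
      exact hpz (e2.symm.trans e1)
    have hsq : s ≠ q := fun e => hqZ (e ▸ hs)
    have b1 := meet_mem_left (P := P) D (join L s q)
    have b2 := meet_mem_right (P := P) D (join L s q)
    set a := meet P D (join L s q) with ha
    have has : a ≠ s := fun e => hsD (e ▸ b1)
    have haZ : a ∉ Z := fun h => has (point_eq (hsa q hqZ) b2 (left_mem_join _ _) h hs)
    refine ⟨⟨a, b1, haZ⟩, ?_⟩
    change S a = p
    have e1 : join L s a = join L s q :=
      line_eq has (right_mem_join _ _) (left_mem_join _ _) b2 (left_mem_join _ _)
    have e2 : w a = q := point_eq (l := V₁) (m := join L s q)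
      (fun e => hs₁ (e ▸ left_mem_join _ _)) (hw₁ a) a1 (e1 ▸ hws a) (right_mem_join _ _)
    have e3 : join L o (w a) = join L o p :=
      line_eq (hwo a) (left_mem_join _ _) (right_mem_join _ _) (left_mem_join _ _) (e2 ▸ a2)
    exact point_eq (hjo p) (e3 ▸ hSo a) (right_mem_join _ _) (hSZ a) hp
  · change S o = s
    have e1 : join L o (w o) = join L s o :=
      line_eq (hwo o) (left_mem_join _ _) (right_mem_join _ _) (right_mem_join _ _) (hws o)
    exact point_eq (hsa o hoZ) (e1 ▸ hSo o) (left_mem_join _ _) (hSZ o) hs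
  · rintro ⟨a, ha, haZ⟩
    refine ⟨o, w a, join L o (w a), right_mem_join _ _, right_mem_join _ _, ?_, hws a,
      left_mem_join _ _, hSo a, right_mem_join _ _⟩
    have : join L z u = V₁ := line_eq (fun (e : u = z) => huZ (e ▸ hzZ)) (right_mem_join _ _)
      (left_mem_join _ _) m₁ hz₁
    exact this ▸ hw₁ a
  · rintro ⟨a, ha, haZ⟩
    refine ⟨o, a, D, right_mem_join _ _, right_mem_join _ _, right_mem_join _ _,
      right_mem_join _ _, hoD, ?_, ha⟩
    change S u ∈ D
    -- The unit point `u` is on `V₁` already, so the line from the origin that defines its slope is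
    -- `D`.
    have e1 : w u = u := point_eq (l := V₁) (m := join L s u)
      (fun e => hs₁ (e ▸ left_mem_join _ _)) (hw₁ u) m₁ (hws u) (right_mem_join _ _)
    have e2 : D = join L o (w u) :=
      line_eq hou hoD m₂ (left_mem_join _ _) (e1.symm ▸ right_mem_join o u)
    rw [e2]
    exact hSo u
  · exact line_eq hoz (right_mem_join _ _) (left_mem_join _ _) ho hz₀
  · exact line_eq (fun (e : u = z) => huZ (e ▸ hzZ)) (right_mem_join _ _) (left_mem_join _ _) m₁ hz₁

end Frames

/-! ### Rank three matroids given by lines -/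

section LineMatroids

/-- The ground set of `M` is everything, and `𝓛` is a family of lines of the rank three matroid
`M`. -/
structure Matroid.HasLineFamily {α : Type*} (M : Matroid α) (𝓛 : Set (Set α)) : Prop where
  ground_eq : M.E = Set.univ
  indep_iff : ∀ I, M.Indep I ↔ LineIndep 𝓛 I

/-- `a`, `b` and `c` are on a line of the family. -/
def CollinearIn {α : Type*} (𝓛 : Set (Set α)) (a b c : α) : Prop := ∃ l ∈ 𝓛, a ∈ l ∧ b ∈ l ∧ c ∈ l

theorem collinearIn_left_comm {α : Type*} {𝓛 : Set (Set α)} {a b c : α} :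
    CollinearIn 𝓛 a b c ↔ CollinearIn 𝓛 b a c :=
  exists_congr fun _ => by tauto

theorem collinearIn_right_comm {α : Type*} {𝓛 : Set (Set α)} {a b c : α} :
    CollinearIn 𝓛 a b c ↔ CollinearIn 𝓛 a c b :=
  exists_congr fun _ => by tauto

theorem collinearIn_rotate {α : Type*} {𝓛 : Set (Set α)} {a b c : α} :
    CollinearIn 𝓛 a b c ↔ CollinearIn 𝓛 c a b :=
  exists_congr fun _ => by tauto

theorem encard_triple {α : Type*} {a b c : α} (hab : a ≠ b) (hac : a ≠ c) (hbc : b ≠ c) :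
    ({a, b, c} : Set α).encard = 3 :=
  Set.encard_eq_three.2 ⟨a, b, c, hab, hac, hbc, rfl⟩

/-- A set of at most three elements that has more than two consists of exactly three, so dependence
on a line is always dependence of one triple. This reduces embeddings to collinearity of triples. -/
theorem lineIndep_iff {α : Type*} {𝓛 : Set (Set α)} {I : Set α} :
    LineIndep 𝓛 I ↔ I.encard ≤ 3 ∧ ∀ a ∈ I, ∀ b ∈ I, ∀ c ∈ I, a ≠ b → a ≠ c → b ≠ c →
      ¬ CollinearIn 𝓛 a b c := by
  refine and_congr_right fun h3 => ⟨?_, ?_⟩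
  · rintro h a ha b hb c hc hab hac hbc ⟨l, hl, hal, hbl, hcl⟩
    have hsub : ({a, b, c} : Set α) ⊆ I := by
      rintro x (rfl | rfl | rfl) <;> assumption
    have hfin : I.Finite := Set.finite_of_encard_le_coe (k := 3) h3
    have hI := (hfin.subset hsub).eq_of_subset_of_encard_le hsub
      (by rwa [encard_triple hab hac hbc])
    have := h l hl (by rw [← hI]; rintro x (rfl | rfl | rfl) <;> assumption)
    rw [← hI, encard_triple hab hac hbc] at this
    exact absurd this (by norm_num)
  · intro h l hl hIl
    by_contra! h2
    have h3' : (3 : ℕ∞) ≤ I.encard := by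
      have := Order.add_one_le_of_lt h2
      norm_num at this
      exact this
    obtain ⟨J, hJI, hJ⟩ := Set.exists_subset_encard_eq h3'
    obtain ⟨a, b, c, hab, hac, hbc, rfl⟩ := Set.encard_eq_three.1 hJ
    have ha : a ∈ I := hJI (by simp)
    have hb : b ∈ I := hJI (by simp)
    have hc : c ∈ I := hJI (by simp)
    exact h a ha b hb c hc hab hac hbc ⟨l, hl, hIl ha, hIl hb, hIl hc⟩

theorem lineIndep_triple {α : Type*} {𝓛 : Set (Set α)} {a b c : α} (hab : a ≠ b) (hac : a ≠ c)
    (hbc : b ≠ c) : LineIndep 𝓛 {a, b, c} ↔ ¬ CollinearIn 𝓛 a b c := by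
  constructor
  · intro h
    exact (lineIndep_iff.1 h).2 a (by simp) b (by simp) c (by simp) hab hac hbc
  · refine fun h => ⟨(encard_triple hab hac hbc).le, fun l hl hs => ?_⟩
    exact absurd ⟨l, hl, hs (by simp), hs (by simp), hs (by simp)⟩ h

/-- An embedding of matroids given by lines is an injection that preserves and reflects
collinearity. -/
theorem Matroid.HasLineFamily.isEmbedding_iff {α β : Type*} {M : Matroid α} {N : Matroid β}
    {𝓛 : Set (Set α)} {𝓛' : Set (Set β)} (hM : M.HasLineFamily 𝓛) (hN : N.HasLineFamily 𝓛')
    {f : α → β} : M.IsEmbedding N f ↔ Function.Injective f ∧ ∀ a b c, a ≠ b → a ≠ c → b ≠ c →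
      (CollinearIn 𝓛 a b c ↔ CollinearIn 𝓛' (f a) (f b) (f c)) := by
  constructor
  · rintro ⟨hf, -, h⟩
    rw [hM.ground_eq, Set.injOn_univ] at hf
    refine ⟨hf, fun a b c hab hac hbc => ?_⟩
    have := h {a, b, c} (by simp [hM.ground_eq])
    rw [hM.indep_iff, hN.indep_iff, Set.image_insert_eq, Set.image_pair,
      lineIndep_triple hab hac hbc, lineIndep_triple (hf.ne hab) (hf.ne hac) (hf.ne hbc)] at this
    exact not_iff_not.1 this
  · rintro ⟨hf, h⟩
    refine ⟨hf.injOn, fun _ _ => by simp [hN.ground_eq], fun I _ => ?_⟩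
    rw [hM.indep_iff, hN.indep_iff, lineIndep_iff, lineIndep_iff, hf.encard_image]
    simp only [Set.forall_mem_image, hf.ne_iff]
    refine and_congr_right fun _ => ?_
    refine forall₂_congr fun a _ => forall₂_congr fun b _ => forall₂_congr fun c _ => ?_
    exact forall₃_congr fun hab hac hbc => not_congr (h a b c hab hac hbc)

theorem planeMatroid_hasLineFamily (P L : Type*) [Membership P L]
    [Configuration.ProjectivePlane P L] :
    (planeMatroid P L).HasLineFamily (Set.range fun l : L => {p : P | p ∈ l}) :=
  ⟨rfl, fun _ => lineMatroid_indep_iff⟩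

theorem extendedLiftMatroid_hasLineFamily {Q : Type*} {op : Q → Q → Q} (hop : IsQuasigroup op) :
    (extendedLiftMatroid op hop).HasLineFamily (liftLines op) :=
  ⟨rfl, expansion_liftIndep_iff hop⟩

/-- Deleting e₀ replaces each line by its trace on the edges. A trace with fewer than three elements
does no harm, because it imposes no condition. -/
theorem liftMatroid_hasLineFamily {Q : Type*} {op : Q → Q → Q} (hop : IsQuasigroup op) :
    (liftMatroid op hop).HasLineFamily ((some ⁻¹' ·) '' liftLines op) := by
  refine ⟨rfl, fun I => ?_⟩
  have hs : Function.Injective (some : Q × K3Edge → _) := Option.some_injective _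
  rw [liftMatroid, Matroid.comap_indep_iff, (extendedLiftMatroid_hasLineFamily hop).indep_iff]
  simp [LineIndep, hs.encard_image, hs.injOn, Set.image_subset_iff]

theorem collinearIn_plane_iff {P L : Type*} [Membership P L] {a b c : P} :
    CollinearIn (Set.range fun l : L => {p : P | p ∈ l}) a b c ↔
      ∃ l : L, a ∈ l ∧ b ∈ l ∧ c ∈ l := by
  simp [CollinearIn]

end LineMatroids

/-! ### Realizations on three concurrent lines -/

section Realizations

open Configuration

variable {P L : Type*} [Membership P L] {Q : Type*}

/-- Points `F (g, i)` on three lines `m i` of a pencil with center `z` such that the collinear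
transversal triples are given by the operation `op`. -/
structure IsPencilRealization (op : Q → Q → Q) (F : Q × K3Edge → P) (m : K3Edge → L) (z : P) :
    Prop where
  main_injective : Function.Injective m
  center_mem : ∀ i, z ∈ m i
  mem_main : ∀ e, F e ∈ m e.2
  ne_center : ∀ e, F e ≠ z
  injective : Function.Injective F
  collinear_iff : ∀ x : K3Edge → Q,
    (∃ l : L, ∀ i, F (x i, i) ∈ l) ↔ op (x .e12) (x .e23) = x .e13

theorem K3Edge.eq_of_ne {i j k : K3Edge} (hij : i ≠ j) (hik : i ≠ k) (hjk : j ≠ k) (n : K3Edge) :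
    n = i ∨ n = j ∨ n = k := by
  cases i <;> cases j <;> cases k <;> cases n <;> simp_all

/-- Two terms of the equation `x · y = z` in a quasigroup determine the third. -/
theorem IsQuasigroup.exists_solution {op : Q → Q → Q} (hop : IsQuasigroup op) {i j : K3Edge}
    (hij : i ≠ j) (g h : Q) :
    ∃ x : K3Edge → Q, op (x .e12) (x .e23) = x .e13 ∧ x i = g ∧ x j = h := by
  have H1 : ∀ a b, ∃ x : K3Edge → Q, op (x .e12) (x .e23) = x .e13 ∧ x .e12 = a ∧ x .e23 = b :=
    fun a b => ⟨fun k => K3Edge.casesOn k a b (op a b), rfl, rfl, rfl⟩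
  have H2 : ∀ a c, ∃ x : K3Edge → Q, op (x .e12) (x .e23) = x .e13 ∧ x .e12 = a ∧ x .e13 = c := by
    intro a c
    obtain ⟨b, hb, -⟩ := hop.existsUnique_right a c
    exact ⟨fun k => K3Edge.casesOn k a b c, hb, rfl, rfl⟩
  have H3 : ∀ b c, ∃ x : K3Edge → Q, op (x .e12) (x .e23) = x .e13 ∧ x .e23 = b ∧ x .e13 = c := by
    intro b c
    obtain ⟨a, ha, -⟩ := hop.existsUnique_left b c
    exact ⟨fun k => K3Edge.casesOn k a b c, ha, rfl, rfl⟩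
  have swap : ∀ {i j : K3Edge}, (∃ x : K3Edge → Q, op (x .e12) (x .e23) = x .e13 ∧ x j = h ∧
      x i = g) → ∃ x : K3Edge → Q, op (x .e12) (x .e23) = x .e13 ∧ x i = g ∧ x j = h :=
    fun ⟨x, h1, h2, h3⟩ => ⟨x, h1, h3, h2⟩
  cases i <;> cases j <;> first | exact absurd rfl hij | skip
  exacts [H1 _ _, H2 _ _, swap (H1 _ _), H3 _ _, swap (H2 _ _), swap (H3 _ _)]

variable {op : Q → Q → Q} {F : Q × K3Edge → P} {m : K3Edge → L} {z : P}

/-- A line of the first kind holds edges of one class only, so edges of three classes are collinear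
only in a balanced triangle. Both sides then say that the labels satisfy the equation of `op`. -/
theorem IsPencilRealization.collinearIn_iff_of_ne (h : IsPencilRealization op F m z)
    {a b c : Q × K3Edge} (hab : a.2 ≠ b.2) (hac : a.2 ≠ c.2) (hbc : b.2 ≠ c.2) :
    CollinearIn (liftLines op) (some a) (some b) (some c) ↔
      ∃ l : L, F a ∈ l ∧ F b ∈ l ∧ F c ∈ l := by
  have all := K3Edge.eq_of_ne hab hac hbc
  -- Recording the labels as a function of the class makes the order of the three edges irrelevant.
  obtain ⟨x, ha, hb, hc⟩ : ∃ x : K3Edge → Q, a = (x a.2, a.2) ∧ b = (x b.2, b.2) ∧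
      c = (x c.2, c.2) := by
    classical
    exact ⟨fun i => if i = a.2 then a.1 else if i = b.2 then b.1 else c.1, by simp,
      by simp [hab.symm], by simp [hac.symm, hbc.symm]⟩
  trans op (x .e12) (x .e23) = x .e13
  · constructor
    · rintro ⟨_, ⟨i, rfl⟩ | ⟨_, ⟨g₁, g₂, g₃, hg, rfl⟩, rfl⟩, h1, h2, h3⟩
      · simp at h1 h2
        exact absurd (h1.trans h2.symm) hab
      · have key : ∀ i, (x i, i) ∈
            ({(g₁, .e12), (g₂, .e23), (g₃, .e13)} : Set (Q × K3Edge)) := by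
          intro i
          rw [(Option.some_injective _).mem_set_image] at h1 h2 h3
          rcases all i with rfl | rfl | rfl
          exacts [ha ▸ h1, hb ▸ h2, hc ▸ h3]
        have k1 := key .e12
        have k2 := key .e23
        have k3 := key .e13
        simp at k1 k2 k3
        rw [k1, k2, k3, hg]
    · intro hx
      have key : ∀ i, some (x i, i) ∈ some ''
          ({(x .e12, .e12), (x .e23, .e23), (x .e13, .e13)} : Set (Q × K3Edge)) := by
        intro i
        cases i <;> simp
      exact ⟨_, Or.inr ⟨_, ⟨_, _, _, hx, rfl⟩, rfl⟩, ha ▸ key a.2, hb ▸ key b.2, hc ▸ key c.2⟩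
  · rw [← h.collinear_iff]
    refine exists_congr fun l => ⟨fun hl => ⟨ha ▸ hl a.2, hb ▸ hl b.2, hc ▸ hl c.2⟩, ?_⟩
    rintro ⟨h1, h2, h3⟩ i
    rcases all i with rfl | rfl | rfl
    exacts [ha ▸ h1, hb ▸ h2, hc ▸ h3]

variable [ProjectivePlane P L]

namespace IsPencilRealization

theorem mem_main_iff (h : IsPencilRealization op F m z) {e : Q × K3Edge} {i : K3Edge} :
    F e ∈ m i ↔ e.2 = i := by
  refine ⟨fun h' => h.main_injective ?_, fun h' => h' ▸ h.mem_main e⟩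
  exact line_eq (h.ne_center e) (h.mem_main e) (h.center_mem _) h' (h.center_mem _)

theorem eq_main_of_center_mem (h : IsPencilRealization op F m z) {e : Q × K3Edge} {l : L}
    (hz : z ∈ l) (he : F e ∈ l) : l = m e.2 :=
  line_eq (h.ne_center e) he hz (h.mem_main e) (h.center_mem _)

theorem eq_of_mem (h : IsPencilRealization op F m z) {e f : Q × K3Edge} {l : L} (hz : z ∉ l)
    (he : F e ∈ l) (hf : F f ∈ l) (hef : e.2 = f.2) : e = f :=
  h.injective (point_eq (fun (h' : l = m f.2) => hz (h' ▸ h.center_mem _)) he hf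
    (hef ▸ h.mem_main e) (h.mem_main f))

theorem center_notMem (h : IsPencilRealization op F m z) {e f : Q × K3Edge} {l : L}
    (he : F e ∈ l) (hf : F f ∈ l) (hef : e.2 ≠ f.2) : z ∉ l := fun hz =>
  hef (h.main_injective ((h.eq_main_of_center_mem hz he).symm.trans
    (h.eq_main_of_center_mem hz hf)))

/-- The points on a line through two points in different classes. -/
theorem exists_line_points (h : IsPencilRealization op F m z) (hop : IsQuasigroup op)
    {e f : Q × K3Edge} {l : L} (he : F e ∈ l) (hf : F f ∈ l) (hef : e.2 ≠ f.2) :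
    ∃ x : K3Edge → Q, ∀ g : Q × K3Edge, F g ∈ l ↔ g = (x g.2, g.2) := by
  obtain ⟨x, hx, h1, h2⟩ := hop.exists_solution hef e.1 f.1
  obtain ⟨l', hl'⟩ := (h.collinear_iff x).2 hx
  have e1 : F e ∈ l' := by simpa [h1] using hl' e.2
  have f1 : F f ∈ l' := by simpa [h2] using hl' f.2
  obtain rfl : l = l' := line_eq (h.injective.ne fun h => hef (by rw [h])) he hf e1 f1
  exact ⟨x, fun g => ⟨fun hg => h.eq_of_mem (h.center_notMem he hf hef) hg (hl' g.2) rfl,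
    fun hg => hg ▸ hl' g.2⟩⟩

/-- Two labels in different places of x · y = z determine the third, and collinearity encodes the
equation; so the third point of the net is the solution. -/
theorem isDualThreeNet (h : IsPencilRealization op F m z) (hop : IsQuasigroup op) :
    IsDualThreeNet m (Set.range F) where
  main_injective := h.main_injective
  mem_main := by
    rintro _ ⟨e, rfl⟩
    exact ⟨_, h.mem_main e⟩
  notMem_two := by
    rintro _ ⟨e, rfl⟩ i j hij hi hj
    exact hij ((h.mem_main_iff.1 hi).symm.trans (h.mem_main_iff.1 hj))
  cross := by
    rintro i j k hij - - _ ⟨e, rfl⟩ _ ⟨f, rfl⟩ he hf l hel hfl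
    obtain ⟨x, hx⟩ := h.exists_line_points hop hel hfl
      (by rwa [h.mem_main_iff.1 he, h.mem_main_iff.1 hf])
    exact ⟨F (x k, k), ⟨_, rfl⟩, (hx _).2 rfl, h.mem_main (x k, k)⟩

theorem collinearIn_none_iff (h : IsPencilRealization op F m z) (a b : Q × K3Edge) :
    (CollinearIn (liftLines op) none (some a) (some b) ↔ a.2 = b.2) ∧
      ((∃ l : L, z ∈ l ∧ F a ∈ l ∧ F b ∈ l) ↔ a.2 = b.2) := by
  refine ⟨⟨?_, ?_⟩, ?_, ?_⟩
  · rintro ⟨_, ⟨i, rfl⟩ | ⟨_, ⟨g₁, g₂, g₃, hg, rfl⟩, rfl⟩, h1, h2, h3⟩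
    · simp at h2 h3
      exact h2.trans h3.symm
    · simp at h1
  · intro hab
    exact ⟨_, Or.inl ⟨a.2, rfl⟩, by simp, by simp, by simp [hab]⟩
  · rintro ⟨l, hz, ha, hb⟩
    exact h.mem_main_iff.1 (h.eq_main_of_center_mem hz hb ▸ ha)
  · intro hab
    exact ⟨m a.2, h.center_mem _, h.mem_main a, hab ▸ h.mem_main b⟩

theorem collinearIn_iff_of_eq (h : IsPencilRealization op F m z) {a b c : Q × K3Edge}
    (hne : a ≠ b) (hab : a.2 = b.2) :
    (CollinearIn (liftLines op) (some a) (some b) (some c) ↔ c.2 = a.2) ∧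
      ((∃ l : L, F a ∈ l ∧ F b ∈ l ∧ F c ∈ l) ↔ c.2 = a.2) := by
  refine ⟨⟨?_, ?_⟩, ?_, ?_⟩
  · rintro ⟨_, ⟨i, rfl⟩ | ⟨_, ⟨g₁, g₂, g₃, hg, rfl⟩, rfl⟩, h1, h2, h3⟩
    · simp at h1 h3
      exact h3.trans h1.symm
    · obtain ⟨a, i⟩ := a
      obtain ⟨b, j⟩ := b
      simp at h1 h2 hab hne
      grind
  · intro hc
    exact ⟨_, Or.inl ⟨a.2, rfl⟩, by simp, by simp [hab], by simp [hc]⟩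
  · rintro ⟨l, ha, hb, hc⟩
    by_contra hca
    exact hne (h.eq_of_mem (h.center_notMem hc ha hca) ha hb hab)
  · intro hc
    exact ⟨m a.2, h.mem_main a, hab ▸ h.mem_main b, hc ▸ h.mem_main c⟩

/-- The extension of `F` that maps the extra element to the center. -/
def extend (F : Q × K3Edge → P) (z : P) (e : Option (Q × K3Edge)) : P := e.elim z F

/-- Triples of distinct elements are of three kinds. With e₀, or with two edges in one class,
collinearity in matroid and plane alike means that the edges present share a class. With three
different classes it is the equation of `op`. The symmetry lemmas handle the orderings. -/
theorem isEmbedding_extend (h : IsPencilRealization op F m z) (hop : IsQuasigroup op) :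
    (extendedLiftMatroid op hop).IsEmbedding (planeMatroid P L) (extend F z) := by
  rw [(extendedLiftMatroid_hasLineFamily hop).isEmbedding_iff (planeMatroid_hasLineFamily P L)]
  have n1 : ∀ a b : Q × K3Edge, CollinearIn (liftLines op) none (some a) (some b) ↔
      CollinearIn (Set.range fun l : L => {p : P | p ∈ l}) z (F a) (F b) := fun a b => by
    rw [collinearIn_plane_iff, (h.collinearIn_none_iff a b).1, (h.collinearIn_none_iff a b).2]
  have n2 : ∀ a b c : Q × K3Edge, a ≠ b → a.2 = b.2 →
      (CollinearIn (liftLines op) (some a) (some b) (some c) ↔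
      CollinearIn (Set.range fun l : L => {p : P | p ∈ l}) (F a) (F b) (F c)) :=
    fun a b c hne hab => by
    rw [collinearIn_plane_iff, (h.collinearIn_iff_of_eq hne hab).1,
      (h.collinearIn_iff_of_eq hne hab).2]
  constructor
  · rintro (_ | a) (_ | b) hab
    · rfl
    · exact absurd hab.symm (h.ne_center b)
    · exact absurd hab (h.ne_center a)
    · exact congrArg some (h.injective hab)
  · rintro (_ | a) (_ | b) (_ | c) hab hac hbc <;> first
      | exact absurd rfl hab
      | exact absurd rfl hac
      | exact absurd rfl hbc
      | skip
    · exact n1 b c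
    · exact collinearIn_left_comm.trans ((n1 a c).trans collinearIn_left_comm)
    · exact collinearIn_rotate.trans ((n1 a b).trans collinearIn_rotate.symm)
    · rw [Ne, Option.some_inj] at hab hac hbc
      by_cases e1 : a.2 = b.2
      · exact n2 a b c hab e1
      by_cases e2 : a.2 = c.2
      · exact collinearIn_right_comm.trans ((n2 a c b hac e2).trans collinearIn_right_comm)
      by_cases e3 : b.2 = c.2
      · exact collinearIn_rotate.symm.trans ((n2 b c a hbc e3).trans collinearIn_rotate)
      · rw [h.collinearIn_iff_of_ne e1 e2 e3]
        exact collinearIn_plane_iff.symm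

end IsPencilRealization

theorem Matroid.IsEmbedding.restrict_some {op : Q → Q → Q} {hop : IsQuasigroup op}
    {f : Option (Q × K3Edge) → P}
    (hf : (extendedLiftMatroid op hop).IsEmbedding (planeMatroid P L) f) :
    (liftMatroid op hop).IsEmbedding (planeMatroid P L) (f ∘ some) := by
  rw [(extendedLiftMatroid_hasLineFamily hop).isEmbedding_iff
    (planeMatroid_hasLineFamily P L)] at hf
  rw [(liftMatroid_hasLineFamily hop).isEmbedding_iff (planeMatroid_hasLineFamily P L)]
  refine ⟨hf.1.comp (Option.some_injective _), fun a b c hab hac hbc => ?_⟩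
  refine Iff.trans ?_ (hf.2 (some a) (some b) (some c) (by simpa using hab) (by simpa using hac)
    (by simpa using hbc))
  simp [CollinearIn]

/-- An embedding of the lift matroid with each parallel class on its own line of a pencil. -/
theorem isPencilRealization_of_isEmbedding {op : Q → Q → Q} {hop : IsQuasigroup op}
    {F : Q × K3Edge → P} {m : K3Edge → L} {z : P}
    (hF : (liftMatroid op hop).IsEmbedding (planeMatroid P L) F) (hm : Function.Injective m)
    (hz : ∀ i, z ∈ m i) (hFm : ∀ e, F e ∈ m e.2) (hne : ∀ e, F e ≠ z) :
    IsPencilRealization op F m z := by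
  rw [(liftMatroid_hasLineFamily hop).isEmbedding_iff (planeMatroid_hasLineFamily P L)] at hF
  refine ⟨hm, hz, hFm, hne, hF.1, fun x => ?_⟩
  have := hF.2 (x .e12, .e12) (x .e23, .e23) (x .e13, .e13) (by simp) (by simp) (by simp)
  rw [collinearIn_plane_iff] at this
  trans ∃ l : L, F (x .e12, .e12) ∈ l ∧ F (x .e23, .e23) ∈ l ∧ F (x .e13, .e13) ∈ l
  · refine exists_congr fun l => ⟨fun h => ⟨h _, h _, h _⟩, fun h i => ?_⟩
    cases i
    exacts [h.1, h.2.1, h.2.2]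
  rw [← this]
  constructor
  · rintro ⟨_, ⟨_, ⟨i, rfl⟩ | ⟨_, ⟨g₁, g₂, g₃, hg, rfl⟩, rfl⟩, rfl⟩, h1, h2, h3⟩
    · simp at h1 h2
      exact absurd (h1.trans h2.symm) (by simp)
    · simp at h1 h2 h3
      rw [h1, h2, h3, hg]
  · intro hx
    exact ⟨_, ⟨_, Or.inr ⟨_, ⟨_, _, _, hx, rfl⟩, rfl⟩, rfl⟩, by simp, by simp, by simp⟩

/-- The center is the image of e₀, and the image of any one edge of a class spans a main line with
it. The rest of the class is on that line because the class with e₀ is a line of the matroid. The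
main lines differ because e₀ is on no line with edges of two classes. -/
theorem embedsAsPoints_iff [Nonempty Q] {op : Q → Q → Q} {hop : IsQuasigroup op} :
    EmbedsAsPoints P L (extendedLiftMatroid op hop) ↔
      ∃ (F : Q × K3Edge → P) (m : K3Edge → L) (z : P), IsPencilRealization op F m z := by
  constructor
  · rintro ⟨f, hf⟩
    obtain ⟨q⟩ := ‹Nonempty Q›
    have hf' := hf
    rw [(extendedLiftMatroid_hasLineFamily hop).isEmbedding_iff
      (planeMatroid_hasLineFamily P L)] at hf'
    obtain ⟨hinj, hcol⟩ := hf'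
    simp only [collinearIn_plane_iff] at hcol
    have hne : ∀ e, f (some e) ≠ f none := fun e h => absurd (hinj h) (by simp)
    refine ⟨f ∘ some, fun i => join L (f none) (f (some (q, i))), f none,
      isPencilRealization_of_isEmbedding hf.restrict_some ?_ (fun i => left_mem_join _ _) ?_ hne⟩
    · intro i j hij
      replace hij : join L (f none) (f (some (q, i))) = join L (f none) (f (some (q, j))) := hij
      by_contra hne
      obtain ⟨_, ⟨k, rfl⟩ | ⟨_, ⟨g₁, g₂, g₃, hg, rfl⟩, rfl⟩, h1, h2, h3⟩ :=
        (hcol none (some (q, i)) (some (q, j)) (by simp) (by simp) (by simpa using hne)).2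
          ⟨_, left_mem_join _ _, right_mem_join _ _, hij ▸ right_mem_join _ _⟩
      · simp at h2 h3
        exact hne (h2.trans h3.symm)
      · simp at h1
    · rintro ⟨g, i⟩
      by_cases hg : g = q
      · subst hg
        exact right_mem_join _ _
      obtain ⟨l, h1, h2, h3⟩ :=
        (hcol none (some (q, i)) (some (g, i)) (by simp) (by simp) (by simpa [eq_comm] using hg)).1
          ⟨_, Or.inl ⟨i, rfl⟩, by simp, by simp, by simp⟩
      have := line_eq (hne (q, i)) h2 h1 (right_mem_join (L := L) _ _) (left_mem_join _ _)
      exact this ▸ h3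
  · rintro ⟨F, m, z, h⟩
    exact ⟨_, h.isEmbedding_extend hop⟩

/-- The common point of the main lines is the center. No point of the net equals it, since a net
point is not on two main lines. -/
theorem embedsAsDualAffineThreeNet_iff {op : Q → Q → Q} {hop : IsQuasigroup op} :
    EmbedsAsDualAffineThreeNet P L (liftMatroid op hop) ↔
      ∃ (F : Q × K3Edge → P) (m : K3Edge → L) (z : P), IsPencilRealization op F m z := by
  constructor
  · rintro ⟨f, m, hf, hnet, hfm, z, hz⟩
    refine ⟨f, m, z, isPencilRealization_of_isEmbedding hf hnet.main_injective hz hfm ?_⟩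
    intro e he
    have key := hnet.notMem_two (f e) ⟨e, rfl⟩ .e12 .e23 (by simp)
    rw [he] at key
    exact key (hz _) (hz _)
  · rintro ⟨F, m, z, h⟩
    exact ⟨F, m, (h.isEmbedding_extend hop).restrict_some, h.isDualThreeNet hop, h.mem_main, z,
      h.center_mem⟩

/-- In the dual plane a point other than the centers is a line `l` different from the main lines.
Two net points on `l` are in different classes, so `l` misses `z` and contains exactly one net point
of each class. -/
theorem IsPencilRealization.isThreeNet {op : Q → Q → Q} {F : Q × K3Edge → P} {m : K3Edge → L}
    {z : P} (h : IsPencilRealization op F m z) (hop : IsQuasigroup op) :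
    IsThreeNet (P := Dual L) (L := Dual P) m (Set.range F) := by
  have key : ∀ e f, F e ≠ F f → ∀ l : L, F e ∈ l → F f ∈ l → (∀ i, l ≠ m i) → e.2 ≠ f.2 := by
    intro e f hne l he hf hl hef
    exact hl f.2 (line_eq hne he hf (hef ▸ h.mem_main e) (h.mem_main f))
  refine ⟨h.main_injective, ?_, ?_, ?_⟩
  · rintro _ ⟨e, rfl⟩
    exact ⟨e.2, h.mem_main e, fun i hi => (h.mem_main_iff.1 hi).symm⟩
  · rintro _ ⟨e, rfl⟩ _ ⟨f, rfl⟩ hne (l : L) (he : F e ∈ l) (hf : F f ∈ l) hl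
    obtain ⟨x, hx⟩ := h.exists_line_points hop he hf (key e f hne l he hf hl)
    have hset : {p : P | p ∈ Set.range F ∧ p ∈ l} =
        {F (x .e12, .e12), F (x .e23, .e23), F (x .e13, .e13)} := by
      ext p
      constructor
      · rintro ⟨⟨⟨g, i⟩, rfl⟩, hg⟩
        rw [(hx _).1 hg]
        cases i <;> simp
      · rintro (rfl | rfl | rfl) <;> exact ⟨⟨_, rfl⟩, (hx _).2 rfl⟩
    change {p : P | p ∈ Set.range F ∧ p ∈ l}.encard = 3
    rw [hset]
    exact encard_triple (h.injective.ne (by simp)) (h.injective.ne (by simp))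
      (h.injective.ne (by simp))
  · rintro _ ⟨e, rfl⟩ _ ⟨f, rfl⟩ hne l he hf hl i j hij (n : P) (hi : n ∈ m i) (hj : n ∈ m j) hn
    -- A dual line spanned by two centers is a point common to two main lines, which can only be
    -- `z`.
    have hnz : n = z := point_eq (h.main_injective.ne hij) hi (h.center_mem i) hj (h.center_mem j)
    exact h.center_notMem he hf (key e f hne l he hf hl) (hnz ▸ hn)

theorem embedsAsAffineThreeNet_dual_iff {op : Q → Q → Q} {hop : IsQuasigroup op} :
    EmbedsAsAffineThreeNet (Dual L) (Dual P) (liftMatroid op hop) ↔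
      ∃ (F : Q × K3Edge → P) (m : K3Edge → L) (z : P), IsPencilRealization op F m z := by
  constructor
  · rintro ⟨f, m, hf, hnet, hfm, z, hz⟩
    refine ⟨f, m, z, isPencilRealization_of_isEmbedding (P := P) (L := L) hf hnet.center_injective
      hz hfm ?_⟩
    intro e he
    have key := (hnet.center_mem (f e) ⟨e, rfl⟩).unique (y₁ := .e12) (y₂ := .e23)
    rw [he] at key
    exact absurd (key (hz _) (hz _)) (by simp)
  · rintro ⟨F, m, z, h⟩
    exact ⟨F, m, (h.isEmbedding_extend hop).restrict_some, h.isThreeNet hop, h.mem_main, z,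
      h.center_mem⟩

/-- The matroid of lines is defined through the dual plane, and the double dual unfolds to the
original plane. -/
theorem embedsAsLines_dual_iff {α : Type*} {M : Matroid α} :
    EmbedsAsLines (Dual L) (Dual P) M ↔ EmbedsAsPoints P L M :=
  Iff.rfl

end Realizations

/-! ### Isotopic quasigroups and loops -/

section Isotopy

theorem Isotopic.symm {Q Q' : Type*} {op : Q → Q → Q} {op' : Q' → Q' → Q'}
    (h : Isotopic op op') : Isotopic op' op := by
  obtain ⟨α, β, γ, h⟩ := h
  refine ⟨α.symm, β.symm, γ.symm, fun x y => ?_⟩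
  rw [Equiv.eq_symm_apply, ← h, α.apply_symm_apply, β.apply_symm_apply]

theorem Isotopic.trans {Q Q' Q'' : Type*} {op : Q → Q → Q} {op' : Q' → Q' → Q'}
    {op'' : Q'' → Q'' → Q''} (h : Isotopic op op') (h' : Isotopic op' op'') :
    Isotopic op op'' := by
  obtain ⟨α, β, γ, h⟩ := h
  obtain ⟨α', β', γ', h'⟩ := h'
  exact ⟨α.trans α', β.trans β', γ.trans γ', fun x y => by simp [h', h]⟩

theorem OpIsomorphic.isotopic {Q Q' : Type*} {op : Q → Q → Q} {op' : Q' → Q' → Q'}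
    (h : OpIsomorphic op op') : Isotopic op op' := by
  obtain ⟨f, hf⟩ := h
  exact ⟨f, f, f, fun x y => (hf x y).symm⟩

theorem Isotopic.isostrophic {Q Q' : Type*} {op : Q → Q → Q} {op' : Q' → Q' → Q'}
    (h : Isotopic op op') : Isostrophic op op' :=
  ⟨op, h.symm, 1, fun _ => Iff.rfl⟩

theorem IsQuasigroup.of_isotopic {Q Q' : Type*} {op : Q → Q → Q} {op' : Q' → Q' → Q'}
    (hop : IsQuasigroup op) (h : Isotopic op op') : IsQuasigroup op' := by
  obtain ⟨α, β, γ, h⟩ := h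
  constructor
  · intro x z
    obtain ⟨y, hy, hu⟩ := hop.existsUnique_right (α.symm x) (γ.symm z)
    refine ⟨β y, ?_, fun y' hy' => ?_⟩
    · simpa [hy] using h (α.symm x) y
    · have := h (α.symm x) (β.symm y')
      rw [α.apply_symm_apply, β.apply_symm_apply, hy'] at this
      rw [← hu (β.symm y') (by simp [this]), β.apply_symm_apply]
  · intro y z
    obtain ⟨x, hx, hu⟩ := hop.existsUnique_left (β.symm y) (γ.symm z)
    refine ⟨α x, ?_, fun x' hx' => ?_⟩
    · simpa [hx] using h x (β.symm y)
    · have := h (α.symm x') (β.symm y)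
      rw [α.apply_symm_apply, β.apply_symm_apply, hx'] at this
      rw [← hu (α.symm x') (by simp [this]), α.apply_symm_apply]

theorem IsLoop.of_opIsomorphic {Q Q' : Type*} {op : Q → Q → Q} {op' : Q' → Q' → Q'}
    (hop : IsLoop op) (h : OpIsomorphic op op') : IsLoop op' := by
  refine ⟨hop.1.of_isotopic h.isotopic, ?_⟩
  obtain ⟨-, e, he⟩ := hop
  obtain ⟨f, hf⟩ := h
  refine ⟨f e, fun x => ?_⟩
  obtain ⟨x, rfl⟩ := f.surjective x
  rw [← hf, ← hf, (he x).1, (he x).2]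
  exact ⟨rfl, rfl⟩

/-- Every quasigroup is isotopic to a loop on the same set. -/
theorem IsQuasigroup.exists_isotopic_loop {Q : Type*} [Nonempty Q] {op : Q → Q → Q}
    (hop : IsQuasigroup op) : ∃ op' : Q → Q → Q, IsLoop op' ∧ Isotopic op op' := by
  obtain ⟨a⟩ := ‹Nonempty Q›
  have hα : Function.Bijective fun x => op x a :=
    Function.bijective_iff_existsUnique _ |>.2 fun z => hop.existsUnique_left a z
  have hβ : Function.Bijective fun y => op a y :=
    Function.bijective_iff_existsUnique _ |>.2 fun z => hop.existsUnique_right a z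
  let α := Equiv.ofBijective _ hα
  let β := Equiv.ofBijective _ hβ
  -- Undoing the translations x ↦ x · a and y ↦ a · y before multiplying turns a · a into an
  -- identity.
  have h : Isotopic op fun x y => op (α.symm x) (β.symm y) :=
    ⟨α, β, Equiv.refl Q, fun x y => by simp⟩
  refine ⟨_, ⟨hop.of_isotopic h, op a a, fun x => ⟨?_, ?_⟩⟩, h⟩
  · have : α.symm (op a a) = a := α.symm_apply_apply a
    rw [this]
    exact β.apply_symm_apply x
  · have : β.symm (op a a) = a := β.symm_apply_apply a
    rw [this]
    exact α.apply_symm_apply x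

/-- The image of a loop under an injective homomorphism is an isomorphic subloop. -/
theorem IsLoop.exists_subloop {Q R : Type*} {op : Q → Q → Q} {add : R → R → R} (hop : IsLoop op)
    {f : Q → R} (hf : Function.Injective f) (h : ∀ x y, add (f x) (f y) = f (op x y)) :
    ∃ S : Subquasigroup add, S.IsSubloop ∧ OpIsomorphic op S.restrict := by
  have hmem : ∀ {x y}, x ∈ Set.range f → y ∈ Set.range f → add x y ∈ Set.range f := by
    rintro _ _ ⟨x, rfl⟩ ⟨y, rfl⟩
    exact ⟨op x y, (h x y).symm⟩
  have hiso : OpIsomorphic op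
      fun x y : Set.range f => (⟨add x y, hmem x.2 y.2⟩ : Set.range f) :=
    ⟨Equiv.ofInjective f hf, fun x y => Subtype.ext (h x y).symm⟩
  exact ⟨⟨Set.range f, hmem, hop.1.of_isotopic hiso.isotopic⟩, hop.of_opIsomorphic hiso, hiso⟩

end Isotopy

/-! ### From concurrent lines to coordinates and back -/

section Coordinates

open Configuration

/-- The operation is realized by points on three concurrent lines of the plane. -/
def HasPencilRealization (P L : Type*) [Membership P L] {Q : Type*} (op : Q → Q → Q) : Prop :=
  ∃ (F : Q × K3Edge → P) (m : K3Edge → L) (z : P), IsPencilRealization op F m z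

/-- The three bijections relabel the points on the three main lines independently; the set of points
does not change. -/
theorem HasPencilRealization.of_isotopic {P L : Type*} [Membership P L] {Q Q' : Type*}
    {op : Q → Q → Q} {op' : Q' → Q' → Q'} (h : HasPencilRealization P L op)
    (hi : Isotopic op op') : HasPencilRealization P L op' := by
  obtain ⟨F, m, z, h⟩ := h
  obtain ⟨α, β, γ, hi⟩ := hi
  let e : K3Edge → Q ≃ Q' := fun i => K3Edge.casesOn i α β γ
  refine ⟨fun x => F ((e x.2).symm x.1, x.2), m, z, h.main_injective, h.center_mem,
    fun x => h.mem_main ((e x.2).symm x.1, x.2), fun x => h.ne_center _, ?_, fun x => ?_⟩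
  · rintro ⟨x, i⟩ ⟨y, j⟩ hxy
    have := h.injective hxy
    simp only [Prod.mk.injEq] at this
    obtain ⟨h1, rfl⟩ := this
    rw [(e i).symm.injective h1]
  · rw [h.collinear_iff fun i => (e i).symm (x i)]
    change op (α.symm (x .e12)) (β.symm (x .e23)) = γ.symm (x .e13) ↔ _
    rw [Equiv.eq_symm_apply, ← hi, α.apply_symm_apply, β.apply_symm_apply]

/-- The edges of the triangle as the places of the equation `x · y = z`. -/
def K3Edge.equivFin : K3Edge ≃ Fin 3 where
  toFun i := K3Edge.casesOn i 0 1 2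
  invFun := ![.e12, .e23, .e13]
  left_inv i := by cases i <;> rfl
  right_inv i := by fin_cases i <;> rfl

/-- A realization treats its three lines alike, so permuting the places of the equation amounts to
permuting the main lines. -/
theorem HasPencilRealization.of_conjugate {P L : Type*} [Membership P L] {Q : Type*}
    {op op' : Q → Q → Q} (h : HasPencilRealization P L op') (hc : Conjugate op op') :
    HasPencilRealization P L op := by
  obtain ⟨F, m, z, h⟩ := h
  obtain ⟨σ, hσ⟩ := hc
  let τ : K3Edge ≃ K3Edge := (K3Edge.equivFin.trans σ).trans K3Edge.equivFin.symm
  refine ⟨fun x => F (x.1, τ.symm x.2), m ∘ τ.symm, z, h.main_injective.comp τ.symm.injective,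
    fun i => h.center_mem _, fun x => h.mem_main (x.1, τ.symm x.2), fun x => h.ne_center _, ?_,
    fun x => ?_⟩
  · rintro ⟨x, i⟩ ⟨y, j⟩ hxy
    have := h.injective hxy
    simpa using this
  · refine Iff.trans ?_ (hσ (x ∘ K3Edge.equivFin.symm)).symm
    refine Iff.trans ?_ (h.collinear_iff (x ∘ τ))
    refine exists_congr fun l => ?_
    rw [← τ.forall_congr_right]
    simp

/-- The summand a is placed as the slope [a], the summand b as [0, b] and the sum c as [1, c]. Only
the line ⟨a, b⟩ contains [a] and [0, b], and it contains [1, c] exactly when a + b = c. -/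
theorem TernaryRing.Coordinatizes.hasPencilRealization {P L : Type*} [Membership P L] {R : Type u}
    {T : TernaryRing R} (hT : T.Coordinatizes P L) (S : Subquasigroup T.add) :
    HasPencilRealization P L S.restrict := by
  obtain ⟨f, g, hfg⟩ := hT
  let p : S.carrier × K3Edge → T.Point := fun x =>
    K3Edge.casesOn x.2 (.slope x.1) (.affine T.zero x.1) (.affine T.one x.1)
  let m : K3Edge → T.Line := fun i =>
    K3Edge.casesOn i .infinity (.vertical T.zero) (.vertical T.one)
  have h01 := T.zero_ne_one
  refine ⟨fun x => f.symm (p x), fun i => g.symm (m i), f.symm .vertical, ?_, ?_, ?_, ?_, ?_, ?_⟩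
  · refine g.symm.injective.comp ?_
    intro i j hij
    cases i <;> cases j <;> simp [m, h01, h01.symm] at hij ⊢
  · intro i
    rw [hfg]
    cases i <;> simp [m, TernaryRing.Incident]
  · rintro ⟨x, i⟩
    rw [hfg]
    cases i <;> simp [m, p, TernaryRing.Incident]
  · rintro ⟨x, i⟩ h
    have := f.symm.injective h
    cases i <;> simp [p] at this
  · refine f.symm.injective.comp ?_
    rintro ⟨x, i⟩ ⟨y, j⟩ hxy
    cases i <;> cases j <;> simp [p, h01, h01.symm] at hxy ⊢ <;> exact Subtype.ext hxy
  · intro x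
    have key : S.restrict (x .e12) (x .e23) = x .e13 ↔
        T.t T.one (x .e12) (x .e23) = (x .e13 : R) := Subtype.ext_iff
    rw [key]
    constructor
    · rintro ⟨l, hl⟩
      have h1 := hl .e12
      have h2 := hl .e23
      have h3 := hl .e13
      rw [hfg] at h1 h2 h3
      generalize g l = l' at h1 h2 h3
      cases l' with
      | affine m' k =>
        simp only [p, TernaryRing.Incident, Equiv.apply_symm_apply, T.t_zero_left] at h1 h2 h3
        rw [h1, ← h2, h3]
      | vertical x' => simp [p, TernaryRing.Incident] at h1
      | infinity => simp [p, TernaryRing.Incident] at h2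
    · intro h
      refine ⟨g.symm (.affine (x .e12) (x .e23)), fun i => ?_⟩
      rw [hfg]
      cases i <;> simp [p, TernaryRing.Incident, T.t_zero_left, h]

theorem CoordinateFrame.coordinatizes {P L : Type*} {R : Type u} [Membership P L]
    [ProjectivePlane P L] (F : CoordinateFrame P L R) : F.ternaryRing.Coordinatizes P L := by
  refine ⟨(Equiv.ofBijective _ F.ofPoint_bijective).symm,
    (Equiv.ofBijective _ F.ofLine_bijective).symm, fun p l => ?_⟩
  rw [← F.ofPoint_mem_ofLine]
  congr! 1
  · exact ((Equiv.ofBijective _ F.ofLine_bijective).apply_symm_apply l).symm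
  · exact ((Equiv.ofBijective _ F.ofPoint_bijective).apply_symm_apply p).symm

/-- A loop realized on three concurrent lines is a subloop of the additive loop of the ternary ring
with respect to these lines and the points of the identity. -/
theorem HasPencilRealization.exists_subloop {P : Type u} {L : Type v} [Membership P L]
    [ProjectivePlane P L] {Q : Type w} {op : Q → Q → Q} (h : HasPencilRealization P L op)
    (hop : IsLoop op) :
    ∃ (R : Type u) (T : TernaryRing R), T.Coordinatizes P L ∧
      ∃ S : Subquasigroup T.add, S.IsSubloop ∧ OpIsomorphic op S.restrict := by
  obtain ⟨F, m, z, h⟩ := h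
  obtain ⟨-, e, he⟩ := id hop
  -- The main lines become infinity, x = 0 and x = 1. The identity labels slope zero on the first
  -- and the origin on the second, so that it receives the coordinate 0 on both.
  obtain ⟨R, C, hz, hs, hZ, hV₀, hV₁, ho⟩ := exists_coordinateFrame (h.center_mem .e12)
    (h.center_mem .e23) (h.center_mem .e13) (h.main_injective.ne (by simp))
    (h.main_injective.ne (by simp)) (h.main_injective.ne (by simp)) (h.mem_main (e, .e12))
    (h.ne_center _) (h.mem_main (e, .e23)) (h.ne_center _)
  have hα : ∀ g, ∃ a, C.S a = F (g, .e12) := fun g =>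
    C.S_surjective _ (hZ ▸ h.mem_main (g, .e12)) (hz ▸ h.ne_center _)
  have hV : ∀ {x : R} {i : K3Edge}, i ≠ .e12 → C.V x = m i → ∀ g, ∃ y, F (g, i) = C.pt x y := by
    intro x i hi hx g
    obtain ⟨x', y, hy⟩ := C.exists_eq_pt (p := F (g, i)) fun hZ' =>
      hi (h.mem_main_iff.1 (hZ ▸ hZ'))
    obtain rfl : x' = x := by
      rw [← C.pt_mem_V_iff, ← hy, hx]
      exact h.mem_main (g, i)
    exact ⟨y, hy⟩
  choose α hα using hα
  choose β hβ using hV (by simp) hV₀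
  choose γ hγ using hV (by simp) hV₁
  have hadd : ∀ g h, C.ternaryRing.add (α g) (β h) = γ (op g h) := by
    intro g₁ g₂
    obtain ⟨l, hl⟩ := (h.collinear_iff
      fun i => K3Edge.casesOn i g₁ g₂ (op g₁ g₂)).2 rfl
    have h1 : C.S (α g₁) ∈ l := hα g₁ ▸ hl .e12
    have h2 : C.pt C.zero (β g₂) ∈ l := hβ g₂ ▸ hl .e23
    have h3 : C.pt C.one (γ (op g₁ g₂)) ∈ l := hγ (op g₁ g₂) ▸ hl .e13
    rw [C.eq_ln h1 h2, C.pt_mem_ln_iff] at h3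
    exact h3
  -- So far α, β, γ only form an isotopism into the additive loop. Both `α e` and `β e` are zero, so
  -- products with `e` on the left and on the right force γ = β and α = β.
  have hαe : α e = C.zero := C.S_injective (by rw [hα, C.S_zero, hs])
  have hβe : β e = C.zero := by
    rw [hβ, C.pt_mem_H_iff] at ho
    exact ho
  have hγβ : ∀ g, γ g = β g := by
    intro g
    have := hadd e g
    rw [(he g).1, hαe] at this
    exact this.symm.trans (C.ternaryRing.t_zero_middle _ _)
  have hαβ : ∀ g, α g = β g := by
    intro g
    have := hadd g e
    rw [(he g).2, hβe, hγβ] at this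
    exact (C.ternaryRing.t_one_left _).symm.trans this
  refine ⟨R, C.ternaryRing, C.coordinatizes, hop.exists_subloop (f := β) ?_ fun g₁ g₂ => ?_⟩
  · intro g₁ g₂ hg
    have := h.injective ((hβ g₁).trans ((congrArg _ hg).trans (hβ g₂).symm))
    simpa using this
  · rw [← hγβ (op g₁ g₂), ← hadd, hαβ]

end Coordinates

/-! ### The equivalences -/

theorem theorem4p3 {P : Type u} {L : Type v} [Membership P L]
    [Configuration.ProjectivePlane P L]
    {Q : Type w} [Nonempty Q] (op : Q → Q → Q) (hop : IsQuasigroup op) :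
    List.TFAE [
      EmbedsAsPoints P L (extendedLiftMatroid op hop),
      EmbedsAsDualAffineThreeNet P L (liftMatroid op hop),
      EmbedsAsLines (Configuration.Dual L) (Configuration.Dual P) (extendedLiftMatroid op hop),
      EmbedsAsAffineThreeNet (Configuration.Dual L) (Configuration.Dual P) (liftMatroid op hop),
      ∃ (R : Type u) (T : TernaryRing R), T.Coordinatizes P L ∧
        ∃ S : Subquasigroup T.add, Isostrophic op S.restrict,
      ∃ (R : Type u) (T : TernaryRing R), T.Coordinatizes P L ∧
        ∃ S : Subquasigroup T.add, S.IsSubloop ∧ Isotopic op S.restrict] ∧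
    (IsLoop op →
      (EmbedsAsPoints P L (extendedLiftMatroid op hop) ↔
        ∃ (R : Type u) (T : TernaryRing R), T.Coordinatizes P L ∧
          ∃ S : Subquasigroup T.add, S.IsSubloop ∧ OpIsomorphic op S.restrict)) := by
  have hpoints : EmbedsAsPoints P L (extendedLiftMatroid op hop) ↔ HasPencilRealization P L op :=
    embedsAsPoints_iff
  refine ⟨?_, fun hloop => ⟨fun h => (hpoints.1 h).exists_subloop hloop, ?_⟩⟩
  · tfae_have 1 ↔ 2 := embedsAsPoints_iff.trans embedsAsDualAffineThreeNet_iff.symm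
    tfae_have 1 ↔ 3 := embedsAsLines_dual_iff.symm
    tfae_have 1 ↔ 4 := embedsAsPoints_iff.trans embedsAsAffineThreeNet_dual_iff.symm
    tfae_have 1 → 6 := by
      intro h
      -- Coordinates can be adapted only to an identity element, so the realization is first
      -- relabelled for an isotopic loop.
      obtain ⟨op', hloop, hiso⟩ := hop.exists_isotopic_loop
      obtain ⟨R, T, hT, S, hS, hS'⟩ := ((hpoints.1 h).of_isotopic hiso).exists_subloop hloop
      exact ⟨R, T, hT, S, hS, hiso.trans hS'.isotopic⟩
    tfae_have 6 → 5 := by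
      rintro ⟨R, T, hT, S, -, hS⟩
      exact ⟨R, T, hT, S, hS.isostrophic⟩
    tfae_have 5 → 1 := by
      rintro ⟨R, T, hT, S, op'', hiso, hconj⟩
      exact hpoints.2 (((hT.hasPencilRealization S).of_isotopic hiso).of_conjugate hconj)
    tfae_finish
  · rintro ⟨R, T, hT, S, -, hS⟩
    exact hpoints.2 ((hT.hasPencilRealization S).of_isotopic hS.isotopic.symm)
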